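/- Let $\delta_6,\delta_7,\delta_8,\delta_9$ be Hermitian complex $4\times4$ matrices generating the Euclidean Clifford algebra, $\delta_i\delta_j+\delta_j\delta_i=2\delta_{ij}$, and let $c\in\mathbb R$. On $L^2(\mathbb R^2)\otimes\mathbb C^4$, with coordinates $(x,y)$ on $\mathbb R^2$ and $p_x=-i\partial_x$, $p_y=-i\partial_y$, consider the intersecting Moyal planes given by $$X_L=(x,\;p_x,\;0,\;0),\qquad X_R=(c\,y,\;0,\;y,\;p_y)$$ in the directions $6,7,8,9$, where $X_L$ acts on the first and $X_R$ on the second variable. For $c=0$ these are two orthogonal 2-dimensional Moyal planes; for $c\neq0$ this is the tilted configuration $X^6=x+cy$, $X^7=p_x$, $X^8=y$, $X^9=p_y$. Let $$\Delta=\sum_{i=6}^{9}\delta_i\,(X^i_L-X^i_R)=\delta_6(x-cy)+\delta_7p_x-\delta_8y-\delta_9p_y$$ be the Dirac operator, understood in the sense of distributions on its maximal domain $\{\psi\in L^2:\Delta\psi\in L^2\}$, let $\Delta^2$ be its operator square with domain $\{\psi\in\operatorname{dom}\Delta:\Delta\psi\in\operatorname{dom}\Delta\}$, and let $\theta=i^{-2}\delta_6\delta_7\delta_8\delta_9$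 be the chirality operator. Then: 1. The kernel of $\Delta^2$ is one-dimensional, i.e. up to scalar multiples there is exactly one zero eigenvector of $\Delta^2$. 2. This zero eigenvector has positive chirality: $\theta\psi=\psi$ for all $\psi\in\ker\Delta^2$. 3. The index $\Xi(\Delta)=\operatorname{Tr}\big(P_\Gamma(\Delta^2)\,\theta\big)$ is well defined and equal to $1$. That is: there are simple closed curves $\Gamma\subset\mathbb C$ that encircle the origin and do not meet any eigenvalue of $\Delta^2$, and for every such $\Gamma$ the orthogonal projector $P_\Gamma(\Delta^2)$ on the closed span of the eigenspaces of $\Delta^2$ whose eigenvalues are encircled by $\Gamma$ has finite rank, and $\operatorname{Tr}\big(P_\Gamma(\Delta^2)\,\theta\big)=1$. -/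

import Mathlib

open MeasureTheory
open scoped SchwartzMap InnerProductSpace

noncomputable section

namespace IntersectingBranes

/-! ### Unbounded operators: squares, eigenspaces, traces, and the chirality index -/

section Index

variable {H : Type*} [NormedAddCommGroup H] [InnerProductSpace ℂ H]

/-- The square `T²` of an unbounded operator `T`, with its natural domain
`{ψ ∈ dom T | T ψ ∈ dom T}`. -/
def sq (T : H →ₗ.[ℂ] H) : H →ₗ.[ℂ] H :=
  T.comp (T.domRestrict ((T.domain.comap T.toFun).map T.domain.subtype)) (by
    rintro ⟨_, ⟨⟨y, hy⟩, hyT, rfl⟩, h⟩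
    exact hyT)

/-- The eigenspace `{ψ ∈ dom A | A ψ = μ ψ}` of an unbounded operator `A`. -/
def eigenspace (A : H →ₗ.[ℂ] H) (μ : ℂ) : Submodule ℂ H :=
  (LinearMap.ker (A.toFun - μ • A.domain.subtype)).map A.domain.subtype

theorem mem_eigenspace {A : H →ₗ.[ℂ] H} {μ : ℂ} {ψ : H} :
    ψ ∈ eigenspace A μ ↔ ∃ h : ψ ∈ A.domain, A ⟨ψ, h⟩ = μ • ψ := by
  simp [eigenspace, sub_eq_zero]

/-- `ψ` is in the domain of `T²` iff `ψ` and `T ψ` are in the domain of `T`. -/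
theorem mem_sq_domain {T : H →ₗ.[ℂ] H} {ψ : H} :
    ψ ∈ (sq T).domain ↔ ∃ h : ψ ∈ T.domain, T ⟨ψ, h⟩ ∈ T.domain := by
  change ψ ∈ ((T.domain.comap T.toFun).map T.domain.subtype) ⊓ T.domain ↔ _
  simp

theorem sq_apply {T : H →ₗ.[ℂ] H} {ψ : H} (h : ψ ∈ (sq T).domain) (h₁ : ψ ∈ T.domain)
    (h₂ : T ⟨ψ, h₁⟩ ∈ T.domain) : sq T ⟨ψ, h⟩ = T ⟨T ⟨ψ, h₁⟩, h₂⟩ := rfl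

/-- `μ` is an eigenvalue of `A`. -/
def IsEigenvalue (A : H →ₗ.[ℂ] H) (μ : ℂ) : Prop := eigenspace A μ ≠ ⊥

/-- The closed curve `Γ` encircles `z`: the point `z` does not lie on `Γ`, and its connected
component in the complement of `Γ` is bounded. -/
def Encircles (Γ : C(Circle, ℂ)) (z : ℂ) : Prop :=
  z ∉ Set.range Γ ∧ Bornology.IsBounded (connectedComponentIn (Set.range Γ)ᶜ z)

/-- The closed linear span of all eigenspaces of `A` whose eigenvalues are encircled by `Γ`. -/
def encircledSpace (A : H →ₗ.[ℂ] H) (Γ : C(Circle, ℂ)) : Submodule ℂ H :=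
  (⨆ μ ∈ {μ : ℂ | Encircles Γ μ}, eigenspace A μ).topologicalClosure

/-- `P_Γ(A)`: the orthogonal projector on the eigenspaces of `A` whose eigenvalues are encircled
by `Γ`. -/
def spectralProjector [CompleteSpace H] (A : H →ₗ.[ℂ] H) (Γ : C(Circle, ℂ)) : H →L[ℂ] H :=
  haveI : CompleteSpace (encircledSpace A Γ) :=
    inferInstanceAs (CompleteSpace (Submodule.topologicalClosure _))
  (encircledSpace A Γ).starProjection

/-- The operator `B` has trace `t`: in every Hilbert basis the diagonal matrix elements of `B`
are summable with sum `t`. -/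
def HasTrace (B : H →L[ℂ] H) (t : ℂ) : Prop :=
  ∀ (ι : Type) (b : HilbertBasis ι ℂ H), HasSum (fun k => ⟪b k, B (b k)⟫_ℂ) t

/-- `Γ` is admissible for the index of `T`: a simple closed curve which encircles the origin and
does not meet any eigenvalue of `T²`. -/
def IsAdmissible (T : H →ₗ.[ℂ] H) (Γ : C(Circle, ℂ)) : Prop :=
  Function.Injective Γ ∧ Encircles Γ 0 ∧ ∀ μ ∈ Set.range Γ, ¬ IsEigenvalue (sq T) μ

/-- The index `Ξ(T) = Tr (P_Γ(T²) θ)` of the Dirac operator `T` with respect to the chirality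
operator `θ` is well-defined and equal to `n`: admissible curves exist, and for each of them the
projector `P_Γ(T²)` has finite rank and `Tr (P_Γ(T²) θ) = n`. -/
def HasIndex [CompleteSpace H] (T : H →ₗ.[ℂ] H) (θ : H →L[ℂ] H) (n : ℤ) : Prop :=
  (∃ Γ, IsAdmissible T Γ) ∧
    ∀ Γ, IsAdmissible T Γ →
      FiniteDimensional ℂ (encircledSpace (sq T) Γ) ∧
        HasTrace (spectralProjector (sq T) Γ ∘L θ) n

end Index

/-! ### The Dirac operator on the intersection of two Moyal planes -/

/-- The plane `ℝ²` with the coordinates `x = q 0` and `y = q 1`. -/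
abbrev Plane : Type := EuclideanSpace ℝ (Fin 2)

/-- The spinor space `ℂ⁴`. -/
abbrev Spinor : Type := EuclideanSpace ℂ (Fin 4)

/-- The Hilbert space `L²(ℝ²) ⊗ ℂ⁴` of spinor-valued square-integrable functions. -/
abbrev SpinorL2 : Type := Lp Spinor 2 (volume : Measure Plane)

/-- Position operators on Schwartz spinors: multiplication with `x` (`j = 0`) or `y` (`j = 1`). -/
def pos (j : Fin 2) : 𝓢(Plane, Spinor) →L[ℂ] 𝓢(Plane, Spinor) :=
  SchwartzMap.smulLeftCLM Spinor (fun q : Plane => (q j : ℂ))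

theorem pos_apply (j : Fin 2) (φ : 𝓢(Plane, Spinor)) (q : Plane) :
    pos j φ q = (q j : ℂ) • φ q := by
  have h : (fun q : Plane => (q j : ℂ)).HasTemperateGrowth :=
    (Complex.ofRealCLM.comp (EuclideanSpace.proj j : Plane →L[ℝ] ℝ)).hasTemperateGrowth
  exact SchwartzMap.smulLeftCLM_apply_apply h φ q

/-- Momentum operators on Schwartz spinors: `p_x = -i ∂_x` (`j = 0`) or `p_y = -i ∂_y`
(`j = 1`). -/
def mom (j : Fin 2) : 𝓢(Plane, Spinor) →L[ℂ] 𝓢(Plane, Spinor) :=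
  (-Complex.I) • LineDeriv.lineDerivOpCLM ℂ 𝓢(Plane, Spinor)
    (EuclideanSpace.single j (1 : ℝ) : Plane)

theorem mom_apply (j : Fin 2) (φ : 𝓢(Plane, Spinor)) (q : Plane) :
    mom j φ q = (-Complex.I) • lineDeriv ℝ φ q (EuclideanSpace.single j (1 : ℝ)) := by
  simp [mom, ← SchwartzMap.lineDerivOp_apply]

/-- A spin matrix, acting pointwise on Schwartz spinors. -/
def spin (M : Matrix (Fin 4) (Fin 4) ℂ) : 𝓢(Plane, Spinor) →L[ℂ] 𝓢(Plane, Spinor) :=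
  SchwartzMap.postcompCLM (Matrix.toEuclideanCLM (𝕜 := ℂ) M)

/-- A spin matrix, acting pointwise on `L²` spinors. -/
def spinL2 (M : Matrix (Fin 4) (Fin 4) ℂ) : SpinorL2 →L[ℂ] SpinorL2 :=
  (Matrix.toEuclideanCLM (𝕜 := ℂ) M : Spinor →L[ℂ] Spinor).compLpL 2 volume

/-- The four matrices `δ 0, …, δ 3` (in the embedding directions 6, 7, 8, 9) are Hermitian and
generate the 4-dimensional Euclidean Clifford algebra: `δ_i δ_j + δ_j δ_i = 2 δ_{ij}`. -/
def IsEuclideanClifford (δ : Fin 4 → Matrix (Fin 4) (Fin 4) ℂ) : Prop :=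
  (∀ i, (δ i).IsHermitian) ∧
    ∀ i j, δ i * δ j + δ j * δ i = if i = j then (2 : ℂ) • (1 : Matrix (Fin 4) (Fin 4) ℂ) else 0

/-- The left brane: `X_L = (x, p_x, 0, 0)` in the directions 6, 7, 8, 9. -/
def braneL : Fin 4 → (𝓢(Plane, Spinor) →L[ℂ] 𝓢(Plane, Spinor)) :=
  ![pos 0, mom 0, 0, 0]

/-- The right brane: `X_R = (c y, 0, y, p_y)` in the directions 6, 7, 8, 9. For `c = 0` it is
orthogonal to the left brane; `c ≠ 0` is the tilted configuration `X⁶ = x + c y`. -/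
def braneR (c : ℝ) : Fin 4 → (𝓢(Plane, Spinor) →L[ℂ] 𝓢(Plane, Spinor)) :=
  ![(c : ℂ) • pos 1, 0, pos 1, mom 1]

/-- The Dirac operator `∑ᵢ δ_i (X_L^i - X_R^i)` on Schwartz spinors. -/
def diracSchwartz (δ : Fin 4 → Matrix (Fin 4) (Fin 4) ℂ) (c : ℝ) :
    𝓢(Plane, Spinor) →L[ℂ] 𝓢(Plane, Spinor) :=
  ∑ i, spin (δ i) ∘L (braneL i - braneR c i)

/-- The inclusion of the Schwartz spinors in the `L²` spinors. -/
def incl : 𝓢(Plane, Spinor) →ₗ[ℂ] SpinorL2 :=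
  (SchwartzMap.toLpCLM ℂ Spinor 2 (volume : Measure Plane)).toLinearMap

theorem incl_injective : Function.Injective incl :=
  SchwartzMap.injective_toLp 2 (volume : Measure Plane)

/-- The minimal Dirac operator: the unbounded operator on `L²(ℝ²) ⊗ ℂ⁴` with the Schwartz spinors
as domain. -/
def diracMin (δ : Fin 4 → Matrix (Fin 4) (Fin 4) ℂ) (c : ℝ) : SpinorL2 →ₗ.[ℂ] SpinorL2 where
  domain := LinearMap.range incl
  toFun := incl ∘ₗ (diracSchwartz δ c).toLinearMap ∘ₗ
    (LinearEquiv.ofInjective incl incl_injective).symm.toLinearMap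

/-- The minimal Dirac operator is densely defined, so that its adjoint is the genuine one. -/
theorem dense_diracMin_domain (δ : Fin 4 → Matrix (Fin 4) (Fin 4) ℂ) (c : ℝ) :
    Dense ((diracMin δ c).domain : Set SpinorL2) :=
  SchwartzMap.denseRange_toLpCLM (p := 2) (by simp)

/-- The Dirac operator `Δ` on `L²(ℝ²) ⊗ ℂ⁴` on its maximal domain: the expression
`∑ᵢ δ_i (X_L^i - X_R^i)` being formally self-adjoint, the adjoint of the minimal operator is the
same expression, applied in the sense of distributions, with domain all `ψ ∈ L²` for which
`Δ ψ ∈ L²`. -/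
def dirac (δ : Fin 4 → Matrix (Fin 4) (Fin 4) ℂ) (c : ℝ) : SpinorL2 →ₗ.[ℂ] SpinorL2 :=
  (diracMin δ c).adjoint

/-- The chirality operator `θ = i⁻² δ_6 δ_7 δ_8 δ_9` on `L²(ℝ²) ⊗ ℂ⁴`. -/
def chirality (δ : Fin 4 → Matrix (Fin 4) (Fin 4) ℂ) : SpinorL2 →L[ℂ] SpinorL2 :=
  spinL2 ((Complex.I ^ 2)⁻¹ • (δ 0 * δ 1 * δ 2 * δ 3))

end IntersectingBranes

end

noncomputable section

namespace IntersectingBranes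

/-! The position part of `Δ` sends `(x, y)` to the coefficients `(x - c y, -y)` of `δ_6, δ_8`. This
matrix has determinant `-1` and singular values `w, w⁻¹` with `w - w⁻¹ = c`. The momentum part sends
`(p_x, p_y)` to the coefficients `(p_x, -p_y)` of `δ_7, δ_9`, which is orthogonal. Passing to
singular vectors, both for the coordinates and for the Clifford generators, therefore turns `Δ` into
two anticommuting oscillator blocks with frequencies `w` and `w⁻¹` (`diracSchwartz_eq_oscDirac`),
and `θ` does not change (`normalRotation_product`).

In each block the zero-point energy cancels against the spin term, so `Δ²` is the sum of `2 ω_j`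
times (oscillator number + spin occupation number) (`oscDirac_mul_self`). Creation operators applied
to Gaussians with definite spin occupations are thus Schwartz eigenvectors with energies `2 ω_0 m +
2 ω_1 n`. Energy zero forces all occupations to vanish. This leaves a Gaussian times the range of a
spin projection of trace one (`trace_vacuumProj`), on which `i δ_0 δ_1` and `i δ_2 δ_3` of the
rotated generators both act as `-1`, so that `θ = 1`.

No self-adjointness theorem is needed for the maximal domain. Every `ψ` in the domain of `Δ²` can be
paired with the Schwartz eigenvectors, `Δ²` moves to their side by definition of the adjoint, and
the eigenvectors are total because `exp (-Q)` beats every exponential (`eq_zero_of_inner_excited`).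
Hence they span every eigenspace (`eigenspace_eq_span`).

For the index, a curve encircles only a bounded set, hence finitely many energies. On an eigenspace
with `μ ≠ 0` the operator `Δ` is invertible and anticommutes with `θ`, so the trace of `θ` vanishes
there. Only the kernel contributes, and it contributes `1`. -/

theorem trace_eq_one_of_anticommute {W : Type*} [AddCommGroup W] [Module ℂ W]
    [FiniteDimensional ℂ W] {θ D : Module.End ℂ W} (hanti : θ * D = -(D * θ))
    (hspan : ⨆ μ, (D * D).eigenspace μ = ⊤)
    (hker : Module.finrank ℂ ((D * D).eigenspace 0) = 1)
    (hθ : ∀ w ∈ (D * D).eigenspace 0, θ w = w) : LinearMap.trace ℂ W θ = 1 := by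
  classical
  have hcomm : Commute (D * D) θ := by
    have h : D * θ = -(θ * D) := by rw [hanti, neg_neg]
    change D * D * θ = θ * (D * D)
    rw [mul_assoc, h, mul_neg, ← mul_assoc, h, neg_mul, neg_neg, mul_assoc]
  have hmaps : ∀ μ, Set.MapsTo θ ((D * D).eigenspace μ) ((D * D).eigenspace μ) := fun μ =>
    Module.End.mapsTo_genEigenspace_of_comm hcomm μ 1
  have hmapsD : ∀ μ, Set.MapsTo D ((D * D).eigenspace μ) ((D * D).eigenspace μ) := fun μ =>
    Module.End.mapsTo_genEigenspace_of_comm (show D * D * D = D * (D * D) by rw [mul_assoc]) μ 1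
  have hint : DirectSum.IsInternal (fun μ => (D * D).eigenspace μ) :=
    DirectSum.isInternal_submodule_of_iSupIndep_of_iSup_eq_top
      (Module.End.eigenspaces_iSupIndep _) hspan
  have hfin : {μ | (D * D).eigenspace μ ≠ ⊥}.Finite :=
    WellFoundedGT.finite_ne_bot_of_iSupIndep (Module.End.eigenspaces_iSupIndep _)
  rw [LinearMap.trace_eq_sum_trace_restrict' hint hfin hmaps]
  have h0 : ∀ μ, LinearMap.trace ℂ _ (θ.restrict (hmaps μ)) = if μ = 0 then 1 else 0 := by
    intro μ
    split_ifs with hμ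
    · subst hμ
      have : θ.restrict (hmaps 0) = LinearMap.id := by
        ext w
        exact hθ w w.2
      rw [this, LinearMap.trace_id, hker, Nat.cast_one]
    · set θ' : Module.End ℂ ((D * D).eigenspace μ) := θ.restrict (hmaps μ)
      set D' : Module.End ℂ ((D * D).eigenspace μ) := D.restrict (hmapsD μ)
      have hD : D' * D' = μ • 1 := by
        ext w
        exact Module.End.mem_eigenspace_iff.1 w.2
      -- Cyclicity and anticommutation give `μ tr θ' = tr (θ' D' D') = -tr (D' θ' D') = -μ tr θ'`,
      -- and `μ ≠ 0`.
      have ha : θ' * D' * D' = -(D' * θ' * D') := by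
        ext w
        exact congrArg (fun T : Module.End ℂ W => T (D w)) hanti
      have h1 : μ * LinearMap.trace ℂ _ θ' = LinearMap.trace ℂ _ (θ' * D' * D') := by
        rw [mul_assoc, hD, mul_smul_comm, mul_one, map_smul, smul_eq_mul]
      have h2 : LinearMap.trace ℂ _ (θ' * D' * D') = -(μ * LinearMap.trace ℂ _ θ') := by
        rw [ha, map_neg, LinearMap.trace_mul_comm, ← mul_assoc, hD, smul_mul_assoc,
          one_mul, map_smul, smul_eq_mul]
      have h3 : μ * LinearMap.trace ℂ _ θ' = 0 := by
        have := h1.trans h2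
        linear_combination this / 2
      exact (mul_eq_zero.1 h3).resolve_left hμ
  rw [Finset.sum_congr rfl fun μ _ => h0 μ, Finset.sum_ite_eq', if_pos]
  simp only [Set.Finite.mem_toFinset, Set.mem_ofPred_eq]
  -- The sum runs over nontrivial eigenspaces only, and `0` is among them because its eigenspace has
  -- dimension one.
  intro hbot
  rw [hbot] at hker
  simp at hker

/-! ### Operators with a total family of eigenvectors, and their index -/

section

variable {H : Type*} [NormedAddCommGroup H] [InnerProductSpace ℂ H]

/-- Expanding the projection in an orthonormal basis `u` of `W` turns each diagonal element into a
finite sum over `u`. Parseval's identity in the Hilbert basis then sums each term to `⟪u j, θ (u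
j)⟫`, independently of the Hilbert basis. -/
theorem hasTrace_starProjection_comp [CompleteSpace H] (W : Submodule ℂ H)
    [FiniteDimensional ℂ W] (θ : H →L[ℂ] H) (hθ : ∀ w ∈ W, θ w ∈ W) :
    HasTrace (W.starProjection ∘L θ) (LinearMap.trace ℂ W ((θ : H →ₗ[ℂ] H).restrict hθ)) := by
  intro ι b
  set u := stdOrthonormalBasis ℂ W
  have hP : ∀ k, ⟪b k, (W.starProjection ∘L θ) (b k)⟫_ℂ =
      ∑ j, ⟪(ContinuousLinearMap.adjoint θ) (u j : H), b k⟫_ℂ * ⟪b k, (u j : H)⟫_ℂ := by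
    intro k
    rw [ContinuousLinearMap.comp_apply, Submodule.starProjection_apply,
      ← u.sum_repr' (W.orthogonalProjectionOnto (θ (b k)))]
    simp only [Submodule.coe_sum, Submodule.coe_smul, inner_sum, inner_smul_right,
      ContinuousLinearMap.adjoint_inner_left]
    refine Finset.sum_congr rfl fun j _ => ?_
    congr 1
    rw [Submodule.coe_inner, ← Submodule.starProjection_apply,
      ← Submodule.inner_starProjection_left_eq_right, Submodule.starProjection_eq_self_iff.2 (u j).2]
  simp only [hP]
  rw [LinearMap.trace_eq_sum_inner _ u]
  refine hasSum_sum fun j _ => ?_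
  have h := b.hasSum_inner_mul_inner ((ContinuousLinearMap.adjoint θ) (u j : H)) (u j : H)
  rwa [ContinuousLinearMap.adjoint_inner_left] at h

/-- An eigenvector minus its projection on the span is orthogonal to each `f k`: by construction if
`ν k = μ`, and by `hA` otherwise. Totality makes it zero. Finite multiplicity ensures that the
projection stays inside the eigenspace, without taking closures. -/
theorem eigenspace_eq_span {ι : Type*} {A : H →ₗ.[ℂ] H} {f : ι → H} {ν : ι → ℝ}
    (hf : ∀ k, f k ∈ eigenspace A (ν k))
    (hA : ∀ k (ψ : A.domain), ⟪f k, A ψ⟫_ℂ = (ν k : ℂ) * ⟪f k, (ψ : H)⟫_ℂ)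
    (htotal : ∀ ψ, (∀ k, ⟪f k, ψ⟫_ℂ = 0) → ψ = 0) (hfin : ∀ R : ℝ, {k | |ν k| ≤ R}.Finite)
    (μ : ℂ) : eigenspace A μ = Submodule.span ℂ (f '' {k | (ν k : ℂ) = μ}) := by
  have hle : Submodule.span ℂ (f '' {k | (ν k : ℂ) = μ}) ≤ eigenspace A μ := by
    rw [Submodule.span_le]
    rintro _ ⟨k, rfl, rfl⟩
    exact hf k
  refine le_antisymm (fun ψ hψ => ?_) hle
  set W := Submodule.span ℂ (f '' {k | (ν k : ℂ) = μ}) with hW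
  have : FiniteDimensional ℂ W := by
    refine FiniteDimensional.span_of_finite ℂ (Set.Finite.image _ ((hfin ‖μ‖).subset ?_))
    rintro k rfl
    simp
  have hdiff : ψ - W.starProjection ψ ∈ eigenspace A μ :=
    sub_mem hψ (hle (Submodule.starProjection_apply_mem _ _))
  have h0 : ψ - W.starProjection ψ = 0 := by
    refine htotal _ fun k => ?_
    by_cases hk : (ν k : ℂ) = μ
    · exact (Submodule.sub_starProjection_mem_orthogonal ψ) _
        (Submodule.subset_span ⟨k, hk, rfl⟩)
    · obtain ⟨h1, h2⟩ := mem_eigenspace.1 hdiff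
      have := hA k ⟨_, h1⟩
      rw [h2, inner_smul_right] at this
      have h3 : ((ν k : ℂ) - μ) * ⟪f k, ψ - W.starProjection ψ⟫_ℂ = 0 := by
        rw [sub_mul, ← this, sub_self]
      exact (mul_eq_zero.1 h3).resolve_left (sub_ne_zero.2 hk)
  rw [sub_eq_zero] at h0
  rw [h0]
  exact Submodule.starProjection_apply_mem _ _

theorem isBounded_encircles (Γ : C(Circle, ℂ)) : Bornology.IsBounded {z | Encircles Γ z} := by
  obtain ⟨R, hR⟩ := (isCompact_range Γ.continuous).isBounded.subset_closedBall 0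
  refine (Metric.isBounded_closedBall (x := (0 : ℂ)) (r := max R 0)).subset fun z hz => ?_
  by_contra hzR
  rw [mem_closedBall_zero_iff, not_le, max_lt_iff] at hzR
  -- If `z` lies outside a ball containing the curve, the ray from `z` away from the origin avoids
  -- the curve, so the component of `z` is unbounded.
  have hray : (fun t : ℝ => (t : ℂ) * z) '' Set.Ici 1 ⊆
      connectedComponentIn (Set.range Γ)ᶜ z := by
    refine IsPreconnected.subset_connectedComponentIn
      (isPreconnected_Ici.image _ (by fun_prop)) ⟨1, by simp, by simp⟩ ?_
    rintro _ ⟨t, ht, rfl⟩ hmem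
    have h1 := mem_closedBall_zero_iff.1 (hR hmem)
    have ht' : (1 : ℝ) ≤ t := ht
    rw [norm_mul, Complex.norm_real, Real.norm_of_nonneg (by linarith)] at h1
    nlinarith
  obtain ⟨C, hC⟩ := (hz.2.subset hray).exists_norm_le
  have h1 := hC _ ⟨max 1 (C / ‖z‖ + 1), Set.mem_Ici.2 (le_max_left _ _), rfl⟩
  rw [norm_mul, Complex.norm_real, Real.norm_of_nonneg (by positivity)] at h1
  have h2 : (C / ‖z‖ + 1) * ‖z‖ ≤ C :=
    (mul_le_mul_of_nonneg_right (le_max_right _ _) (norm_nonneg _)).trans h1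
  rw [add_mul, div_mul_cancel₀ _ hzR.2.ne'] at h2
  linarith

/-- The circle of radius `r` around the origin. -/
def circleCurve (r : ℝ) : C(Circle, ℂ) := ⟨fun z => (r : ℂ) * z, by fun_prop⟩

theorem norm_of_mem_range_circleCurve {r : ℝ} (hr : 0 < r) {z : ℂ}
    (hz : z ∈ Set.range (circleCurve r)) : ‖z‖ = r := by
  obtain ⟨w, rfl⟩ := hz
  change ‖(r : ℂ) * (w : ℂ)‖ = r
  rw [norm_mul, Circle.norm_coe, mul_one, Complex.norm_real, Real.norm_of_nonneg hr.le]

theorem circleCurve_injective {r : ℝ} (hr : 0 < r) : Function.Injective (circleCurve r) := by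
  intro z w h
  have : (r : ℂ) * z = r * w := h
  exact Circle.ext (mul_left_cancel₀ (by exact_mod_cast hr.ne') this)

theorem encircles_circleCurve_zero {r : ℝ} (hr : 0 < r) : Encircles (circleCurve r) 0 := by
  refine ⟨fun h => hr.ne (by simpa using norm_of_mem_range_circleCurve hr h), ?_⟩
  refine (Metric.isBounded_ball (x := (0 : ℂ)) (r := r)).subset fun z hz => ?_
  rw [mem_ball_zero_iff]
  by_contra hzr
  -- The norms on the component of `0` form an interval. If it reached beyond `r` it would contain
  -- `r`, and the component would meet the circle.
  have hpre : IsPreconnected (norm '' connectedComponentIn (Set.range (circleCurve r))ᶜ 0) :=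
    isPreconnected_connectedComponentIn.image _ continuous_norm.continuousOn
  have h0 : (0 : ℂ) ∈ connectedComponentIn (Set.range (circleCurve r))ᶜ 0 :=
    mem_connectedComponentIn fun h => hr.ne (by simpa using norm_of_mem_range_circleCurve hr h)
  obtain ⟨w, hw, hwr⟩ := hpre.ordConnected.out ⟨0, h0, norm_zero⟩ ⟨z, hz, rfl⟩
    ⟨hr.le, not_lt.1 hzr⟩
  refine connectedComponentIn_subset _ _ hw ⟨⟨(w / r : ℂ), ?_⟩, ?_⟩
  · rw [Submonoid.unitSphere, Submonoid.mem_mk, Subsemigroup.mem_mk, mem_sphere_zero_iff_norm, norm_div, hwr, Complex.norm_real, Real.norm_of_nonneg hr.le,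
      div_self hr.ne']
  · change (r : ℂ) * (w / r) = w
    rw [mul_div_cancel₀]
    exact_mod_cast hr.ne'

/-- `T T ψ = μ ψ` lies again in the domain of `T`, so `T ψ` is in the domain of `T²` with no further
regularity argument. -/
theorem mapsTo_eigenspace_sq {T : H →ₗ.[ℂ] H} {μ : ℂ} {ψ : H} (hψ : ψ ∈ eigenspace (sq T) μ) :
    ∃ h : ψ ∈ T.domain, T ⟨ψ, h⟩ ∈ eigenspace (sq T) μ ∧
      ∃ h' : T ⟨ψ, h⟩ ∈ T.domain, T ⟨T ⟨ψ, h⟩, h'⟩ = μ • ψ := by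
  obtain ⟨h, hμ⟩ := mem_eigenspace.1 hψ
  obtain ⟨h₁, h₂⟩ := mem_sq_domain.1 h
  rw [sq_apply h h₁ h₂] at hμ
  refine ⟨h₁, mem_eigenspace.2 ?_, h₂, hμ⟩
  have h₃ : T ⟨T ⟨ψ, h₁⟩, h₂⟩ ∈ T.domain := by
    rw [hμ]
    exact T.domain.smul_mem μ h₁
  refine ⟨mem_sq_domain.2 ⟨h₂, h₃⟩, ?_⟩
  rw [sq_apply _ h₂ h₃, ← T.map_smul]
  congr 1
  exact Subtype.ext hμ

/-- The radius `r` lies in a gap of the spectrum, so a circle provides an admissible curve. For any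
admissible curve, everything reduces to `trace_eq_one_of_anticommute` on the finite-dimensional
encircled space. -/
theorem hasIndex_one [CompleteSpace H] {ι : Type*} {T : H →ₗ.[ℂ] H} {θ : H →L[ℂ] H} {f : ι → H}
    {ν : ι → ℝ} (heig : ∀ μ, eigenspace (sq T) μ = Submodule.span ℂ (f '' {k | (ν k : ℂ) = μ}))
    (hfin : ∀ R : ℝ, {k | |ν k| ≤ R}.Finite) {r : ℝ} (hr : 0 < r) (hνr : ∀ k, ν k ≠ r)
    (hν : ∀ k, 0 ≤ ν k) (hθT : ∀ ψ : T.domain, ∃ h : θ ψ ∈ T.domain, T ⟨θ ψ, h⟩ = -θ (T ψ))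
    (hker : Module.finrank ℂ (eigenspace (sq T) 0) = 1)
    (hθ : ∀ ψ ∈ eigenspace (sq T) 0, θ ψ = ψ) : HasIndex T θ 1 := by
  refine ⟨⟨circleCurve r, circleCurve_injective hr, encircles_circleCurve_zero hr, ?_⟩, ?_⟩
  · rintro μ hμ hev
    rw [IsEigenvalue, heig, ne_eq, Submodule.span_eq_bot] at hev
    push Not at hev
    obtain ⟨_, ⟨k, rfl, rfl⟩, -⟩ := hev
    have := norm_of_mem_range_circleCurve hr hμ
    rw [Complex.norm_real, Real.norm_of_nonneg (hν k)] at this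
    exact hνr k this
  rintro Γ ⟨-, hΓ0, -⟩
  have hsup : ⨆ μ ∈ {μ : ℂ | Encircles Γ μ}, eigenspace (sq T) μ =
      Submodule.span ℂ (f '' {k | Encircles Γ (ν k)}) := by
    refine le_antisymm (iSup₂_le fun μ hμ => ?_) (Submodule.span_le.2 ?_)
    · rw [heig]
      refine Submodule.span_mono (Set.image_mono ?_)
      rintro k rfl
      exact hμ
    · rintro _ ⟨k, hk, rfl⟩
      refine Submodule.mem_iSup_of_mem (ν k : ℂ) (Submodule.mem_iSup_of_mem hk ?_)
      rw [heig]
      exact Submodule.subset_span ⟨k, rfl, rfl⟩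
  have hfd : FiniteDimensional ℂ (Submodule.span ℂ (f '' {k | Encircles Γ (ν k)})) := by
    obtain ⟨C, hC⟩ := (isBounded_encircles Γ).exists_norm_le
    refine FiniteDimensional.span_of_finite ℂ (Set.Finite.image _ ((hfin C).subset fun k hk => ?_))
    simpa using hC _ hk
  set E := encircledSpace (sq T) Γ with hE
  -- Finite dimension makes the closure superfluous, so properties of `E` can be checked on
  -- eigenvectors.
  have hEeq : E = ⨆ μ ∈ {μ : ℂ | Encircles Γ μ}, eigenspace (sq T) μ := by
    rw [hE, encircledSpace, hsup]
    exact (Submodule.closed_of_finiteDimensional _).submodule_topologicalClosure_eq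
  have hfdE : FiniteDimensional ℂ E := by
    rw [hEeq, hsup]
    exact hfd
  refine ⟨hfdE, ?_⟩
  have hle : ∀ μ, Encircles Γ μ → eigenspace (sq T) μ ≤ E := fun μ hμ => by
    rw [hEeq]
    exact le_iSup₂_of_le μ hμ le_rfl
  -- This single inclusion says both that `E` lies in the domain of `T` and that `T` maps `E` to
  -- itself. The unbounded operator becomes an endomorphism `D` of `E`.
  have hET : E ≤ (E.comap T.toFun).map T.domain.subtype := by
    conv_lhs => rw [hEeq]
    refine iSup₂_le fun μ hμ ψ hψ => ?_
    obtain ⟨h, h', -⟩ := mapsTo_eigenspace_sq hψ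
    exact ⟨⟨ψ, h⟩, hle μ hμ h', rfl⟩
  have hETdom : E ≤ T.domain := hET.trans (Submodule.map_subtype_le _ _)
  have hETE : ∀ w : E, T ⟨w, hETdom w.2⟩ ∈ E := by
    intro w
    obtain ⟨ψ, hψ, hψw⟩ := hET w.2
    have : ψ = ⟨w, hETdom w.2⟩ := Subtype.ext hψw
    rw [← this]
    exact hψ
  let D : Module.End ℂ E :=
    (T.toFun ∘ₗ Submodule.inclusion hETdom).codRestrict E hETE
  have hDD : ∀ {μ : ℂ} {ψ : H} (hψ : ψ ∈ E), ψ ∈ eigenspace (sq T) μ ↔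
      (⟨ψ, hψ⟩ : E) ∈ (D * D).eigenspace μ := by
    intro μ ψ hψ
    rw [Module.End.mem_eigenspace_iff]
    constructor
    · intro h
      obtain ⟨h₁, h₂, h₃, h₄⟩ := mapsTo_eigenspace_sq h
      exact Subtype.ext h₄
    · intro h
      have h₂ : T ⟨ψ, hETdom hψ⟩ ∈ T.domain := hETdom (hETE ⟨ψ, hψ⟩)
      refine mem_eigenspace.2 ⟨mem_sq_domain.2 ⟨hETdom hψ, h₂⟩, ?_⟩
      rw [sq_apply _ (hETdom hψ) h₂]
      exact congrArg Subtype.val h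
  have hθE : ∀ w ∈ E, θ w ∈ E := by
    suffices E ≤ E.comap (θ : H →ₗ[ℂ] H) from this
    conv_lhs => rw [hEeq]
    refine iSup₂_le fun μ hμ ψ hψ => hle μ hμ ?_
    obtain ⟨h₁, h₂, h₃, h₄⟩ := mapsTo_eigenspace_sq hψ
    obtain ⟨h₅, h₆⟩ := hθT ⟨ψ, h₁⟩
    obtain ⟨h₇, h₈⟩ := hθT ⟨_, h₃⟩
    have h₉ : T ⟨θ ψ, h₅⟩ ∈ T.domain := by
      rw [h₆]
      exact neg_mem h₇
    refine mem_eigenspace.2 ⟨mem_sq_domain.2 ⟨h₅, h₉⟩, ?_⟩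
    change sq T ⟨θ ψ, _⟩ = μ • θ ψ
    rw [sq_apply _ h₅ h₉]
    have h₁₀ : (⟨T ⟨θ ψ, h₅⟩, h₉⟩ : T.domain) = -⟨_, h₇⟩ := Subtype.ext h₆
    rw [h₁₀, T.map_neg, h₈, neg_neg, h₄, map_smul]
  have htr := hasTrace_starProjection_comp E θ hθE
  rw [trace_eq_one_of_anticommute (D := D)] at htr
  · rw [Int.cast_one]
    exact htr
  · ext w
    obtain ⟨h₅, h₆⟩ := hθT ⟨w, hETdom w.2⟩
    change θ (T ⟨w, hETdom w.2⟩) = -T ⟨θ w, _⟩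
    rw [h₆, neg_neg]
  · refine eq_top_iff.2 fun w _ => ?_
    have hmap : E ≤ (⨆ μ, (D * D).eigenspace μ).map E.subtype := by
      conv_lhs => rw [hEeq]
      refine iSup₂_le fun μ hμ ψ hψ => ?_
      exact ⟨⟨ψ, hle μ hμ hψ⟩, Submodule.mem_iSup_of_mem μ ((hDD _).1 hψ), rfl⟩
    obtain ⟨w', hw', hww'⟩ := hmap w.2
    rwa [← Subtype.ext hww']
  · rw [← hker]
    refine LinearEquiv.finrank_eq (LinearEquiv.ofBijective
      ((E.subtype ∘ₗ ((D * D).eigenspace 0).subtype).codRestrict (eigenspace (sq T) 0)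
        fun w => (hDD w.1.2).2 w.2) ⟨fun a b hab => ?_, fun ψ => ?_⟩)
    · have h : ((a : E) : H) = (b : E) := congrArg (fun ψ : eigenspace (sq T) 0 => (ψ : H)) hab
      exact Subtype.ext (Subtype.ext h)
    · exact ⟨⟨⟨ψ, hle 0 hΓ0 ψ.2⟩, (hDD _).1 ψ.2⟩, rfl⟩
  · intro w hw
    exact Subtype.ext (hθ w ((hDD w.2).2 hw))

end

/-! ### Gaussians as Schwartz functions -/

section Gaussian

variable {E : Type*} [NormedAddCommGroup E]

/-- The power is bounded by `p!` times `exp (1 + t)`, and completing the square in `t - a t²` gives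
the constant `1 / (4 a)`. -/
theorem one_add_pow_mul_exp_neg_le {a t : ℝ} (ha : 0 < a) (ht : 0 ≤ t) (p : ℕ) :
    (1 + t) ^ p * Real.exp (-(a * t ^ 2)) ≤ p.factorial * Real.exp (1 + 1 / (4 * a)) := by
  have h1 : (1 + t) ^ p ≤ p.factorial * Real.exp (1 + t) := by
    have := Real.pow_div_factorial_le_exp (1 + t) (by positivity) p
    rwa [div_le_iff₀ (by positivity), mul_comm] at this
  have h2 : 1 + t + -(a * t ^ 2) ≤ 1 + 1 / (4 * a) := by
    have : 1 / (4 * a) - t + a * t ^ 2 = a * (t - 1 / (2 * a)) ^ 2 := by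
      field_simp
      ring
    nlinarith [mul_nonneg ha.le (sq_nonneg (t - 1 / (2 * a)))]
  calc (1 + t) ^ p * Real.exp (-(a * t ^ 2))
      ≤ p.factorial * Real.exp (1 + t) * Real.exp (-(a * t ^ 2)) := by gcongr
    _ = p.factorial * Real.exp (1 + t + -(a * t ^ 2)) := by rw [mul_assoc, ← Real.exp_add]
    _ ≤ _ := by gcongr

variable [NormedSpace ℝ E]

/-- The function `exp (-Q)` is a Schwartz function if `Q` has temperate growth and is bounded below
by a multiple of the squared norm. -/
def expNegSchwartz (Q : E → ℝ) (hQ : Q.HasTemperateGrowth) {a : ℝ} (ha : 0 < a)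
    (hQa : ∀ x, a * ‖x‖ ^ 2 ≤ Q x) : 𝓢(E, ℝ) where
  toFun x := Real.exp (-Q x)
  smooth' := Real.contDiff_exp.comp hQ.1.neg
  decay' k n := by
    obtain ⟨m, C, hC, hbound⟩ := hQ.neg.norm_iteratedFDeriv_le_uniform n
    refine ⟨n.factorial * (max 1 C) ^ n * ((m * n + k).factorial * Real.exp (1 + 1 / (4 * a))),
      fun x => ?_⟩
    have h1x : 1 ≤ 1 + ‖x‖ := by linarith [norm_nonneg x]
    -- The composition estimate wants the `i`-th derivative bounded by an `i`-th power. Enlarging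
    -- the base to at least `1` makes the bound of temperate growth imply this.
    have hD : ∀ i, 1 ≤ i → i ≤ n →
        ‖iteratedFDeriv ℝ i (-Q) x‖ ≤ (max 1 C * (1 + ‖x‖) ^ m) ^ i := by
      intro i hi hin
      calc ‖iteratedFDeriv ℝ i (-Q) x‖ ≤ C * (1 + ‖x‖) ^ m := hbound i hin x
        _ ≤ max 1 C * (1 + ‖x‖) ^ m := by
          gcongr
          exact le_max_right _ _
        _ ≤ _ := le_self_pow₀ (one_le_mul_of_one_le_of_one_le (le_max_left _ _)
            (one_le_pow₀ h1x)) (by omega)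
    have hcomp := norm_iteratedFDeriv_comp_le (𝕜 := ℝ) (g := Real.exp) (f := -Q) (n := n)
      (N := n) (C := Real.exp (-Q x)) Real.contDiff_exp (hQ.neg.1.of_le (by exact_mod_cast le_top))
      le_rfl x
      (fun i _ => by
        rw [norm_iteratedFDeriv_eq_norm_iteratedDeriv, iteratedDeriv_eq_iterate,
          Real.iter_deriv_exp, Real.norm_of_nonneg (Real.exp_pos _).le]
        rfl) hD
    calc ‖x‖ ^ k * ‖iteratedFDeriv ℝ n (fun x => Real.exp (-Q x)) x‖
        ≤ (1 + ‖x‖) ^ k *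
          (n.factorial * Real.exp (-(a * ‖x‖ ^ 2)) * (max 1 C * (1 + ‖x‖) ^ m) ^ n) := by
          gcongr
          · linarith
          · refine hcomp.trans ?_
            gcongr
            exact hQa x
      _ = n.factorial * (max 1 C) ^ n *
          ((1 + ‖x‖) ^ (m * n + k) * Real.exp (-(a * ‖x‖ ^ 2))) := by
          rw [mul_pow, ← pow_mul, pow_add]
          ring
      _ ≤ _ := by
          exact mul_le_mul_of_nonneg_left (one_add_pow_mul_exp_neg_le ha (norm_nonneg x) _)
            (by positivity)

theorem expNegSchwartz_apply (Q : E → ℝ) (hQ : Q.HasTemperateGrowth) {a : ℝ} (ha : 0 < a)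
    (hQa : ∀ x, a * ‖x‖ ^ 2 ≤ Q x) (x : E) : expNegSchwartz Q hQ ha hQa x = Real.exp (-Q x) := rfl

end Gaussian

/-! ### Injectivity of the Fourier transform on integrable functions -/

section Fourier

open scoped FourierTransform

variable {E F : Type*} [NormedAddCommGroup E] [InnerProductSpace ℝ E] [FiniteDimensional ℝ E]
  [MeasurableSpace E] [BorelSpace E] [NormedAddCommGroup F] [NormedSpace ℂ F] [CompleteSpace F]

/-- An integrable function with vanishing Fourier transform is zero. -/
theorem ae_eq_zero_of_fourier_eq_zero {f : E → F} (hf : Integrable f) (h : ∀ ξ, 𝓕 f ξ = 0) :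
    ∀ᵐ x, f x = 0 := by
  refine ae_eq_zero_of_integral_contDiff_smul_eq_zero hf.locallyIntegrable fun g hg hgs => ?_
  have hg' : ContDiff ℝ (⊤ : ℕ∞) (fun x => (g x : ℂ)) := Complex.ofRealCLM.contDiff.comp hg
  have hgs' : HasCompactSupport (fun x => (g x : ℂ)) :=
    hgs.comp_left (g := Complex.ofReal) Complex.ofReal_zero
  set φ : 𝓢(E, ℂ) := hgs'.toSchwartzMap hg'
  set χ : 𝓢(E, ℂ) := 𝓕⁻ φ with hχ
  -- The test function `g` is the Fourier transform of a Schwartz function `χ`, so the transform can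
  -- be moved from `χ` to `f`, where it vanishes.
  have hflip := VectorFourier.integral_fourierIntegral_smul_eq_flip (L := innerₗ E)
    (μ := volume) (ν := volume) Real.continuous_fourierChar continuous_inner
    χ.integrable hf
  have h1 : ∀ x, VectorFourier.fourierIntegral Real.fourierChar volume (innerₗ E) χ x
      = g x := by
    intro x
    change 𝓕 (χ : E → ℂ) x = _
    rw [← SchwartzMap.fourier_coe, hχ, FourierTransform.fourier_fourierInv_eq]
    rfl
  have h2 : ∀ x, VectorFourier.fourierIntegral Real.fourierChar volume (innerₗ E).flip f x = 0 := by
    intro x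
    rw [flip_innerₗ]
    exact h x
  simp only [h1, h2, smul_zero, integral_zero] at hflip
  simpa using hflip

end Fourier

/-! ### Totality of polynomials times `exp (-Q)` -/

section Total

/-- Multiplication of Schwartz spinors with the real coordinate `⟪e, q⟫`. -/
def posAlong (e : Plane) : 𝓢(Plane, Spinor) →L[ℂ] 𝓢(Plane, Spinor) :=
  SchwartzMap.smulLeftCLM Spinor (fun q : Plane => ((⟪e, q⟫_ℝ : ℝ) : ℂ))

theorem posAlong_apply (e : Plane) (φ : 𝓢(Plane, Spinor)) (q : Plane) :
    posAlong e φ q = ((⟪e, q⟫_ℝ : ℝ) : ℂ) • φ q := by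
  have h : (fun q : Plane => ((⟪e, q⟫_ℝ : ℝ) : ℂ)).HasTemperateGrowth :=
    (Complex.ofRealCLM.comp (innerSL ℝ e)).hasTemperateGrowth
  exact SchwartzMap.smulLeftCLM_apply_apply h φ q

theorem posAlong_pow_apply (e : Plane) (n : ℕ) (φ : 𝓢(Plane, Spinor)) (q : Plane) :
    ((posAlong e) ^ n) φ q = ((⟪e, q⟫_ℝ : ℝ) : ℂ) ^ n • φ q := by
  induction n with
  | zero => simp
  | succ n ih =>
    rw [pow_succ', mul_apply_eq_comp, posAlong_apply, ih, smul_smul, ← pow_succ']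

theorem inner_incl_eq_integral (φ : 𝓢(Plane, Spinor)) (ψ : SpinorL2) :
    ⟪incl φ, ψ⟫_ℂ = ∫ q, ⟪φ q, ψ q⟫_ℂ := by
  rw [L2.inner_def]
  refine integral_congr_ae ?_
  filter_upwards [φ.coeFn_toLp 2 volume] with q hq
  change ⟪(φ.toLp 2 volume) q, ψ q⟫_ℂ = _
  rw [hq]

variable {Q : Plane → ℝ} (hQ : Q.HasTemperateGrowth) {a : ℝ} (ha : 0 < a)
  (hQa : ∀ x, a * ‖x‖ ^ 2 ≤ Q x)

/-- The constant spinor `v` times the function `exp (-Q)`. -/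
def gaussSpinor (v : Spinor) : 𝓢(Plane, Spinor) :=
  SchwartzMap.postcompCLM (𝕜 := ℝ) (ContinuousLinearMap.toSpanSingleton ℝ v)
    (expNegSchwartz Q hQ ha hQa)

theorem gaussSpinor_apply (v : Spinor) (q : Plane) :
    gaussSpinor hQ ha hQa v q = (Real.exp (-Q q) : ℂ) • v := by
  change Real.exp (-Q q) • v = _
  exact (Complex.coe_smul _ _).symm

include hQ ha hQa in
-- Half of the quadratic decay absorbs the exponential, `R ‖q‖ - a ‖q‖² ≤ R² / (2 a) - (a / 2)
-- ‖q‖²`. The remaining Gaussian is square integrable, as is `ψ`.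
theorem integrable_exp_mul_exp_neg_mul_norm (ψ : SpinorL2) (R : ℝ) :
    Integrable fun q => Real.exp (R * ‖q‖) * (Real.exp (-Q q) * ‖ψ q‖) := by
  have hQ' : (fun q : Plane => a / 2 * ‖q‖ ^ 2).HasTemperateGrowth :=
    (Function.HasTemperateGrowth.const (a / 2)).mul (Function.hasTemperateGrowth_norm_sq _)
  have hg := (expNegSchwartz _ hQ' (half_pos ha) fun _ => le_rfl).memLp 2 (volume : Measure Plane)
  have hint := (hg.integrable_mul (Lp.memLp ψ).norm).const_mul (Real.exp (R ^ 2 / (2 * a)))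
  have hcQ : Continuous Q := hQ.1.continuous
  refine hint.mono' ?_ (Filter.Eventually.of_forall fun q => ?_)
  · exact (by fun_prop : Continuous fun q : Plane => Real.exp (R * ‖q‖)).aestronglyMeasurable.mul
      ((by fun_prop : Continuous fun q : Plane => Real.exp (-Q q)).aestronglyMeasurable.mul
        (Lp.aestronglyMeasurable ψ).norm)
  · rw [Real.norm_of_nonneg (by positivity), Pi.mul_apply, expNegSchwartz_apply, ← mul_assoc,
      ← mul_assoc, ← Real.exp_add, ← Real.exp_add]
    refine mul_le_mul_of_nonneg_right (Real.exp_le_exp.2 ?_) (norm_nonneg _)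
    have h1 : R ^ 2 / (2 * a) - R * ‖q‖ + a / 2 * ‖q‖ ^ 2 = a / 2 * (‖q‖ - R / a) ^ 2 := by
      field_simp
      ring
    have h2 := hQa q
    nlinarith [mul_nonneg (half_pos ha).le (sq_nonneg (‖q‖ - R / a))]

open scoped FourierTransform in
/-- The polynomials times `exp (-Q)` are total in `L²`. -/
theorem eq_zero_of_inner_posAlong_pow_gaussSpinor {ψ : SpinorL2}
    (h : ∀ (e : Plane) (n : ℕ) (v : Spinor),
      ⟪incl (((posAlong e) ^ n) (gaussSpinor hQ ha hQa v)), ψ⟫_ℂ = 0) : ψ = 0 := by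
  set F : Plane → Spinor := fun q => (Real.exp (-Q q) : ℂ) • ψ q with hF
  have hcQ : Continuous Q := hQ.1.continuous
  have hFm : AEStronglyMeasurable F := by
    exact AEStronglyMeasurable.smul (f := fun q => (Real.exp (-Q q) : ℂ))
      (Continuous.aestronglyMeasurable (by fun_prop)) (Lp.aestronglyMeasurable ψ)
  have hFn : ∀ q, ‖F q‖ = Real.exp (-Q q) * ‖ψ q‖ := fun q => by
    rw [hF, norm_smul, Complex.norm_real, Real.norm_of_nonneg (Real.exp_pos _).le]
  have hexp : ∀ R : ℝ, Integrable fun q => Real.exp (R * ‖q‖) * ‖F q‖ := fun R => by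
    simp only [hFn]
    exact integrable_exp_mul_exp_neg_mul_norm hQ ha hQa ψ R
  have hFi : Integrable F := by
    refine (hexp 0).mono' hFm (Filter.Eventually.of_forall fun q => ?_)
    simp
  have hmom : ∀ (e : Plane) (n : ℕ), ∫ q, ((⟪e, q⟫_ℝ : ℝ) : ℂ) ^ n • F q = 0 := by
    intro e n
    -- A nonintegrable integrand would have integral `0` by convention, so integrability need not be
    -- proved here.
    by_cases hi : Integrable fun q => ((⟪e, q⟫_ℝ : ℝ) : ℂ) ^ n • F q
    swap
    · exact integral_undef hi
    refine ext_inner_left ℂ fun v => ?_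
    rw [← integral_inner hi, inner_zero_right, ← h e n v, inner_incl_eq_integral]
    refine integral_congr_ae (Filter.Eventually.of_forall fun q => ?_)
    simp only [posAlong_pow_apply, gaussSpinor_apply, hF, inner_smul_left, inner_smul_right,
      map_pow, Complex.conj_ofReal]
  have hfour : ∀ ξ, 𝓕 F ξ = 0 := by
    intro ξ
    rw [Real.fourier_eq']
    -- The Fourier kernel is expanded in powers of `⟪ξ, q⟫`, with `exp (2π ‖ξ‖ ‖q‖) ‖F q‖`
    -- dominating. Every term is a vanishing moment; powers of a single linear form suffice.
    have hsum := hasSum_integral_of_dominated_convergence (μ := (volume : Measure Plane))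
      (F := fun n q => ((n.factorial : ℂ)⁻¹ * (-2 * Real.pi * Complex.I) ^ n) •
        (((⟪ξ, q⟫_ℝ : ℝ) : ℂ) ^ n • F q))
      (f := fun q => Complex.exp (((-2 * Real.pi * ⟪q, ξ⟫_ℝ : ℝ) : ℂ) * Complex.I) • F q)
      (fun n q => ((n.factorial : ℝ)⁻¹ * (2 * Real.pi * ‖ξ‖ * ‖q‖) ^ n) * ‖F q‖)
      (fun n => ?_) (fun n => ?_) ?_ ?_ ?_
    · simp only [integral_smul, hmom, smul_zero] at hsum
      exact (hsum.unique hasSum_zero)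
    · have hm : AEStronglyMeasurable fun q => ((⟪ξ, q⟫_ℝ : ℝ) : ℂ) ^ n • F q :=
        AEStronglyMeasurable.smul (f := fun q => ((⟪ξ, q⟫_ℝ : ℝ) : ℂ) ^ n)
          (Continuous.aestronglyMeasurable (by fun_prop)) hFm
      exact hm.const_smul ((n.factorial : ℂ)⁻¹ * (-2 * Real.pi * Complex.I) ^ n)
    · refine Filter.Eventually.of_forall fun q => ?_
      simp only [norm_smul, norm_mul, norm_inv, norm_pow, Complex.norm_natCast, norm_neg,
        Complex.norm_real, Complex.norm_I, Complex.norm_ofNat, mul_one,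
        Real.norm_of_nonneg Real.pi_pos.le]
      rw [← mul_assoc, mul_assoc _ _ (_ ^ n), ← mul_pow]
      have := norm_inner_le_norm (𝕜 := ℝ) ξ q
      have hpi := Real.pi_pos
      rw [mul_assoc (2 * Real.pi)]
      gcongr
    · exact Filter.Eventually.of_forall fun q =>
        ((by simpa [div_eq_inv_mul] using
          Real.summable_pow_div_factorial (2 * Real.pi * ‖ξ‖ * ‖q‖) :
          Summable fun n : ℕ => (n.factorial : ℝ)⁻¹ * (2 * Real.pi * ‖ξ‖ * ‖q‖) ^ n)).mul_right _
    · refine (hexp (2 * Real.pi * ‖ξ‖)).congr (Filter.Eventually.of_forall fun q => ?_)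
      simp only [tsum_mul_right]
      rw [Real.exp_eq_exp_ℝ, NormedSpace.exp_eq_tsum_div]
      simp only [div_eq_inv_mul]
    · refine Filter.Eventually.of_forall fun q => ?_
      have h1 := NormedSpace.expSeries_div_hasSum_exp
        (((-2 * Real.pi * ⟪q, ξ⟫_ℝ : ℝ) : ℂ) * Complex.I)
      rw [← Complex.exp_eq_exp_ℂ] at h1
      refine (h1.smul_const (F q)).congr_fun ?_
      intro n
      rw [smul_smul, real_inner_comm]
      congr 1
      push_cast
      rw [div_eq_inv_mul, mul_assoc, ← mul_pow]
      congr 2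
      ring
  have h0 := ae_eq_zero_of_fourier_eq_zero hFi hfour
  rw [Lp.eq_zero_iff_ae_eq_zero]
  filter_upwards [h0] with q hq
  exact (smul_eq_zero.1 hq).resolve_left (by exact_mod_cast (Real.exp_pos _).ne')

end Total

/-! ### Position, derivative and spin operators and their commutation relations -/

section Operators

/-- Continuous operators on the Schwartz spinors. -/
abbrev SchwartzOp : Type := 𝓢(Plane, Spinor) →L[ℂ] 𝓢(Plane, Spinor)

/-- The directional derivative of Schwartz spinors. -/
def derivAlong (e : Plane) : SchwartzOp := LineDeriv.lineDerivOpCLM ℂ 𝓢(Plane, Spinor) e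

theorem derivAlong_apply (e : Plane) (φ : 𝓢(Plane, Spinor)) (q : Plane) :
    derivAlong e φ q = fderiv ℝ φ q e := by
  rw [derivAlong, LineDeriv.lineDerivOpCLM_apply, SchwartzMap.lineDerivOp_apply_eq_fderiv]

theorem spin_apply (M : Matrix (Fin 4) (Fin 4) ℂ) (φ : 𝓢(Plane, Spinor)) (q : Plane) :
    spin M φ q = Matrix.toEuclideanCLM (𝕜 := ℂ) M (φ q) := rfl

theorem posAlong_add (e e' : Plane) : posAlong (e + e') = posAlong e + posAlong e' := by
  ext φ q : 2
  simp [posAlong_apply, inner_add_left, add_smul]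

theorem posAlong_smul (a : ℝ) (e : Plane) : posAlong (a • e) = (a : ℂ) • posAlong e := by
  ext φ q : 2
  simp [posAlong_apply, real_inner_smul_left, mul_smul]

theorem derivAlong_add (e e' : Plane) : derivAlong (e + e') = derivAlong e + derivAlong e' := by
  ext φ q : 2
  simp [derivAlong_apply]

theorem derivAlong_smul (a : ℝ) (e : Plane) : derivAlong (a • e) = (a : ℂ) • derivAlong e := by
  ext φ q : 2
  simp [derivAlong_apply]

theorem pos_eq_posAlong (j : Fin 2) : pos j = posAlong (EuclideanSpace.single j 1) := by
  ext φ q : 2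
  simp [posAlong_apply, pos_apply, EuclideanSpace.inner_single_left]

theorem mom_eq_derivAlong (j : Fin 2) :
    mom j = (-Complex.I) • derivAlong (EuclideanSpace.single j 1) := rfl

/-- Spin matrices act on Schwartz spinors by an algebra homomorphism. -/
def spinHom : Matrix (Fin 4) (Fin 4) ℂ →ₐ[ℂ] SchwartzOp where
  toFun := spin
  map_one' := by
    ext φ q : 2
    simp [spin_apply]
  map_mul' M N := by
    ext φ q : 2
    simp [spin_apply, mul_apply_eq_comp]
  map_zero' := by
    ext φ q : 2
    simp [spin_apply]
  map_add' M N := by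
    ext φ q : 2
    simp [spin_apply]
  commutes' a := by
    ext φ q : 2
    rw [spin_apply, Algebra.algebraMap_eq_smul_one, Algebra.algebraMap_eq_smul_one, map_smul]
    simp

theorem spinHom_apply (M : Matrix (Fin 4) (Fin 4) ℂ) : spinHom M = spin M := rfl

theorem commute_posAlong (e e' : Plane) : Commute (posAlong e) (posAlong e') := by
  ext φ q : 2
  simp only [mul_apply_eq_comp, posAlong_apply]
  exact smul_comm _ _ _

theorem commute_derivAlong (e e' : Plane) : Commute (derivAlong e) (derivAlong e') := by
  ext φ q : 2
  have h2 : ∀ a b : Plane, derivAlong a (derivAlong b φ) q = fderiv ℝ (fderiv ℝ φ) q a b := by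
    intro a b
    rw [derivAlong_apply]
    have h1 : (derivAlong b φ : Plane → Spinor) = fun x => fderiv ℝ φ x b := by
      ext1 x
      exact derivAlong_apply b φ x
    have hd : DifferentiableAt ℝ (fderiv ℝ φ) q :=
      ((φ.smooth 2).fderiv_right (m := 1) (by norm_num)).differentiable (by norm_num) q
    rw [h1, fderiv_clm_apply hd (differentiableAt_const b)]
    simp
  simp only [mul_apply_eq_comp, h2]
  exact ((φ.smooth 2).contDiffAt.isSymmSndFDerivAt (by simp)) e e'

/-- The product rule; these are the canonical commutation relations for arbitrary directions. -/
theorem derivAlong_mul_posAlong (e e' : Plane) :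
    derivAlong e * posAlong e' = posAlong e' * derivAlong e + ((⟪e', e⟫_ℝ : ℝ) : ℂ) • 1 := by
  ext φ q : 2
  have h1 : (posAlong e' φ : Plane → Spinor) = fun x => ⟪e', x⟫_ℝ • φ x := by
    ext1 x
    rw [posAlong_apply, Complex.coe_smul]
  have h2 : HasFDerivAt (fun x : Plane => ⟪e', x⟫_ℝ) (innerSL ℝ e') q := (innerSL ℝ e').hasFDerivAt
  rw [mul_apply_eq_comp, derivAlong_apply, h1, (h2.fun_smul φ.differentiableAt.hasFDerivAt).fderiv]
  simp [mul_apply_eq_comp, derivAlong_apply, posAlong_apply]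

theorem commute_spin_posAlong (M : Matrix (Fin 4) (Fin 4) ℂ) (e : Plane) :
    Commute (spin M) (posAlong e) := by
  ext φ q : 2
  simp [mul_apply_eq_comp, spin_apply, posAlong_apply]

theorem commute_spin_derivAlong (M : Matrix (Fin 4) (Fin 4) ℂ) (e : Plane) :
    Commute (spin M) (derivAlong e) := by
  ext φ q : 2
  have h1 : (spin M φ : Plane → Spinor) =
      ((Matrix.toEuclideanCLM (𝕜 := ℂ) M).restrictScalars ℝ) ∘ φ := rfl
  rw [mul_apply_eq_comp, mul_apply_eq_comp, spin_apply, derivAlong_apply, derivAlong_apply, h1,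
    (((Matrix.toEuclideanCLM (𝕜 := ℂ) M).restrictScalars ℝ).hasFDerivAt.comp q
      φ.differentiableAt.hasFDerivAt).fderiv]
  rfl

end Operators

/-! ### Formal self-adjointness -/

section Symmetric

/-- Formal self-adjointness of an operator on the Schwartz spinors. -/
def IsFormallySymmetric (S : SchwartzOp) : Prop :=
  ∀ φ χ, ⟪incl (S φ), incl χ⟫_ℂ = ⟪incl φ, incl (S χ)⟫_ℂ

theorem inner_incl_incl (φ χ : 𝓢(Plane, Spinor)) :
    ⟪incl φ, incl χ⟫_ℂ = ∫ q, ⟪φ q, χ q⟫_ℂ :=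
  SchwartzMap.inner_toL2_toL2_eq φ χ volume

theorem IsFormallySymmetric.add {S T : SchwartzOp} (hS : IsFormallySymmetric S)
    (hT : IsFormallySymmetric T) : IsFormallySymmetric (S + T) := fun φ χ => by
  simp [inner_add_left, inner_add_right, hS φ χ, hT φ χ]

theorem IsFormallySymmetric.real_smul {S : SchwartzOp} (hS : IsFormallySymmetric S) (a : ℝ) :
    IsFormallySymmetric ((a : ℂ) • S) := fun φ χ => by
  rw [smul_apply, smul_apply, map_smul, map_smul, inner_smul_left, inner_smul_right, hS φ χ,
    Complex.conj_ofReal]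

theorem IsFormallySymmetric.mul {S T : SchwartzOp} (hS : IsFormallySymmetric S)
    (hT : IsFormallySymmetric T) (h : Commute S T) : IsFormallySymmetric (S * T) := fun φ χ => by
  rw [mul_apply_eq_comp, hS, hT, ← mul_apply_eq_comp, ← h.eq]

theorem isFormallySymmetric_posAlong (e : Plane) : IsFormallySymmetric (posAlong e) := fun φ χ => by
  simp only [inner_incl_incl, posAlong_apply, inner_smul_left, inner_smul_right,
    Complex.conj_ofReal]

theorem isFormallySymmetric_derivAlong (e : Plane) :
    IsFormallySymmetric ((-Complex.I) • derivAlong e) := fun φ χ => by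
  have h : ∫ q, ⟪φ q, derivAlong e χ q⟫_ℂ = -∫ q, ⟪derivAlong e φ q, χ q⟫_ℂ :=
    SchwartzMap.integral_bilinear_lineDerivOp_right_eq_neg_left (μ := volume) φ χ
      (isBoundedBilinearMap_inner (𝕜 := ℂ) (E := Spinor)).toContinuousLinearMap e
  simp only [inner_incl_incl, smul_apply, inner_smul_left, inner_smul_right, integral_const_mul, h]
  simp

theorem isFormallySymmetric_spin {M : Matrix (Fin 4) (Fin 4) ℂ} (hM : M.IsHermitian) :
    IsFormallySymmetric (spin M) := fun φ χ => by
  have h : ContinuousLinearMap.adjoint (Matrix.toEuclideanCLM (𝕜 := ℂ) M) =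
      Matrix.toEuclideanCLM (𝕜 := ℂ) M := by
    rw [← ContinuousLinearMap.star_eq_adjoint, ← map_star]
    exact congrArg _ hM
  simp only [inner_incl_incl, spin_apply]
  refine integral_congr_ae (Filter.Eventually.of_forall fun q => ?_)
  change ⟪Matrix.toEuclideanCLM (𝕜 := ℂ) M (φ q), χ q⟫_ℂ =
    ⟪φ q, Matrix.toEuclideanCLM (𝕜 := ℂ) M (χ q)⟫_ℂ
  conv_lhs => rw [← h]
  exact ContinuousLinearMap.adjoint_inner_left _ _ _

end Symmetric

/-! ### Clifford algebra and spin occupation numbers -/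

section Clifford

variable {δ : Fin 4 → Matrix (Fin 4) (Fin 4) ℂ}

theorem IsEuclideanClifford.mul_self (hδ : IsEuclideanClifford δ) (i : Fin 4) :
    δ i * δ i = 1 := by
  have h := hδ.2 i i
  rw [if_pos rfl, ← two_smul ℂ] at h
  exact smul_right_injective _ (two_ne_zero' ℂ) h

theorem IsEuclideanClifford.mul_comm_neg (hδ : IsEuclideanClifford δ) {i j : Fin 4} (hij : i ≠ j) :
    δ i * δ j = -(δ j * δ i) := by
  have h := hδ.2 i j
  rw [if_neg hij] at h
  exact eq_neg_of_add_eq_zero_left h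

/-- A real orthogonal transformation of Clifford generators yields Clifford generators. -/
theorem IsEuclideanClifford.rotate (hδ : IsEuclideanClifford δ) {O : Matrix (Fin 4) (Fin 4) ℝ}
    (hO : O * O.transpose = 1) : IsEuclideanClifford fun i => ∑ k, (O i k : ℂ) • δ k := by
  refine ⟨fun i => ?_, fun i j => ?_⟩
  · rw [Matrix.IsHermitian, Matrix.conjTranspose_sum]
    refine Finset.sum_congr rfl fun k _ => ?_
    rw [Matrix.conjTranspose_smul, (hδ.1 k).eq]
    simp
  · have h1 : (∑ k, (O i k : ℂ) • δ k) * (∑ l, (O j l : ℂ) • δ l) +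
        (∑ k, (O j k : ℂ) • δ k) * (∑ l, (O i l : ℂ) • δ l) =
        ∑ k, ∑ l, ((O i k : ℂ) * O j l) • (δ k * δ l + δ l * δ k) := by
      rw [Finset.sum_mul_sum, Finset.sum_mul_sum, Finset.sum_comm (γ := Fin 4) (f := fun k l =>
        (O j k : ℂ) • δ k * (O i l : ℂ) • δ l), ← Finset.sum_add_distrib]
      refine Finset.sum_congr rfl fun k _ => ?_
      rw [← Finset.sum_add_distrib]
      refine Finset.sum_congr rfl fun l _ => ?_
      rw [smul_mul_smul_comm, smul_mul_smul_comm, smul_add, mul_comm (O j l : ℂ)]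
    rw [h1]
    simp only [hδ.2, smul_ite, smul_zero, Finset.sum_ite_eq, Finset.mem_univ, if_true]
    rw [← Finset.sum_smul]
    have h2 : ∑ k, (O i k : ℂ) * O j k = if i = j then 1 else 0 := by
      have := congrFun (congrFun hO i) j
      rw [Matrix.mul_apply, Matrix.one_apply] at this
      simp only [Matrix.transpose_apply] at this
      rw [← Complex.ofReal_one, ← Complex.ofReal_zero, ← apply_ite Complex.ofReal, ← this]
      simp
    rw [h2, ite_smul, one_smul, zero_smul]

/-- The spin occupation number `(1 + i s t) / 2`. -/
def spinNumber (s t : Matrix (Fin 4) (Fin 4) ℂ) : Matrix (Fin 4) (Fin 4) ℂ :=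
  (2⁻¹ : ℂ) • (1 + Complex.I • (s * t))

/-- Anticommutation gives `(s t)² = -1`, so `i s t` is an involution. -/
theorem spinNumber_mul_self {s t : Matrix (Fin 4) (Fin 4) ℂ} (hs : s * s = 1) (ht : t * t = 1)
    (hst : s * t = -(t * s)) : spinNumber s t * spinNumber s t = spinNumber s t := by
  have h : s * t * (s * t) = -1 := by
    calc s * t * (s * t) = s * (t * s) * t := by noncomm_ring
      _ = -((s * s) * (t * t)) := by
        rw [show t * s = -(s * t) by rw [hst, neg_neg]]
        noncomm_ring
      _ = -1 := by rw [hs, ht, one_mul]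
  simp only [spinNumber, smul_mul_assoc, mul_smul_comm, add_mul, mul_add, one_mul, mul_one, h,
    smul_add, smul_smul, smul_neg]
  match_scalars <;> first | ring1 | linear_combination (-1 / 4 : ℂ) * Complex.I_mul_I

/-- The spectral projections of the spin occupation number. -/
def spinProj (s t : Matrix (Fin 4) (Fin 4) ℂ) (ε : Bool) : Matrix (Fin 4) (Fin 4) ℂ :=
  if ε then spinNumber s t else 1 - spinNumber s t

theorem spinNumber_mul_spinProj {s t : Matrix (Fin 4) (Fin 4) ℂ} (hs : s * s = 1) (ht : t * t = 1)
    (hst : s * t = -(t * s)) (ε : Bool) :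
    spinNumber s t * spinProj s t ε = (ε.toNat : ℂ) • spinProj s t ε := by
  cases ε <;> simp [spinProj, mul_sub, spinNumber_mul_self hs ht hst]

theorem spinProj_mul_self {s t : Matrix (Fin 4) (Fin 4) ℂ} (hs : s * s = 1) (ht : t * t = 1)
    (hst : s * t = -(t * s)) (ε : Bool) :
    spinProj s t ε * spinProj s t ε = spinProj s t ε := by
  cases ε <;> simp [spinProj, mul_sub, sub_mul, spinNumber_mul_self hs ht hst]

theorem spinProj_add (s t : Matrix (Fin 4) (Fin 4) ℂ) :
    spinProj s t true + spinProj s t false = 1 := by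
  simp [spinProj]

theorem IsEuclideanClifford.commute_mul (hδ : IsEuclideanClifford δ) :
    Commute (δ 0 * δ 1) (δ 2 * δ 3) := by
  have h (i j : Fin 4) (hij : i ≠ j := by decide) : δ i * δ j = -(δ j * δ i) :=
    hδ.mul_comm_neg hij
  have h1 : ∀ i : Fin 4, i ≠ 0 → i ≠ 1 → Commute (δ 0 * δ 1) (δ i) := fun i h0 h1 => by
    change δ 0 * δ 1 * δ i = δ i * (δ 0 * δ 1)
    rw [mul_assoc, h 1 i h1.symm, mul_neg, ← mul_assoc, h 0 i h0.symm, neg_mul, neg_neg, mul_assoc]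
  exact (h1 2 (by decide) (by decide)).mul_right (h1 3 (by decide) (by decide))

theorem IsEuclideanClifford.commute_spinNumber (hδ : IsEuclideanClifford δ) :
    Commute (spinNumber (δ 0) (δ 1)) (spinNumber (δ 2) (δ 3)) := by
  have h1 : Commute (1 + Complex.I • (δ 0 * δ 1)) (1 + Complex.I • (δ 2 * δ 3)) :=
    ((Commute.one_right _).add_right ((Commute.one_left _).add_left
      ((hδ.commute_mul.smul_left _).smul_right _)))
  exact (h1.smul_left _).smul_right _

theorem IsEuclideanClifford.commute_spinProj (hδ : IsEuclideanClifford δ) (ε ε' : Bool) :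
    Commute (spinProj (δ 0) (δ 1) ε) (spinProj (δ 2) (δ 3) ε') := by
  have h := hδ.commute_spinNumber
  have h1 : Commute (spinProj (δ 0) (δ 1) ε) (spinNumber (δ 2) (δ 3)) := by
    cases ε
    · exact (Commute.one_left _).sub_left h
    · exact h
  cases ε'
  · exact (Commute.one_right _).sub_right h1
  · exact h1

/-- The projection on the spinors with vanishing occupation numbers. -/
def vacuumProj (δ : Fin 4 → Matrix (Fin 4) (Fin 4) ℂ) : Matrix (Fin 4) (Fin 4) ℂ :=
  spinProj (δ 0) (δ 1) false * spinProj (δ 2) (δ 3) false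

theorem IsEuclideanClifford.spinProj_mul_self_left (hδ : IsEuclideanClifford δ) (ε : Bool) :
    spinProj (δ 0) (δ 1) ε * spinProj (δ 0) (δ 1) ε = spinProj (δ 0) (δ 1) ε :=
  spinProj_mul_self (hδ.mul_self 0) (hδ.mul_self 1) (hδ.mul_comm_neg (by decide)) ε

theorem IsEuclideanClifford.spinProj_mul_self_right (hδ : IsEuclideanClifford δ) (ε : Bool) :
    spinProj (δ 2) (δ 3) ε * spinProj (δ 2) (δ 3) ε = spinProj (δ 2) (δ 3) ε :=
  spinProj_mul_self (hδ.mul_self 2) (hδ.mul_self 3) (hδ.mul_comm_neg (by decide)) ε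

theorem IsEuclideanClifford.vacuumProj_mul_self (hδ : IsEuclideanClifford δ) :
    vacuumProj δ * vacuumProj δ = vacuumProj δ := by
  rw [vacuumProj, ((hδ.commute_spinProj false false).symm).mul_mul_mul_comm,
    hδ.spinProj_mul_self_left, hδ.spinProj_mul_self_right]

theorem IsEuclideanClifford.vacuumProj_eq (δ : Fin 4 → Matrix (Fin 4) (Fin 4) ℂ) :
    vacuumProj δ = (4⁻¹ : ℂ) • (1 - Complex.I • (δ 0 * δ 1) - Complex.I • (δ 2 * δ 3) -
      δ 0 * δ 1 * δ 2 * δ 3) := by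
  have h : δ 0 * δ 1 * (δ 2 * δ 3) = δ 0 * δ 1 * δ 2 * δ 3 := by noncomm_ring
  simp only [vacuumProj, spinProj, spinNumber, Bool.false_eq_true, if_false]
  simp only [sub_mul, mul_sub, smul_mul_assoc, mul_smul_comm, add_mul, mul_add, one_mul, mul_one, h,
    smul_add, smul_sub, smul_smul]
  match_scalars <;> ring_nf
  norm_num

/-- Only the identity term of the expansion has a trace, namely `4 / 4`. A product of two or four
distinct generators changes sign when its first factor is moved to the end, so cyclicity makes its
trace vanish. -/
theorem IsEuclideanClifford.trace_vacuumProj (hδ : IsEuclideanClifford δ) :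
    (vacuumProj δ).trace = 1 := by
  have h (i j : Fin 4) (hij : i ≠ j := by decide) : δ i * δ j = -(δ j * δ i) :=
    hδ.mul_comm_neg hij
  have h2 : ∀ i j : Fin 4, i ≠ j → (δ i * δ j).trace = 0 := fun i j hij => by
    have h1 := congrArg Matrix.trace (h i j hij)
    rw [Matrix.trace_neg, Matrix.trace_mul_comm (δ j)] at h1
    exact self_eq_neg.1 h1
  have h4 : (δ 0 * δ 1 * δ 2 * δ 3).trace = 0 := by
    have h1 : δ 0 * (δ 1 * δ 2 * δ 3) = -(δ 1 * δ 2 * δ 3 * δ 0) := by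
      simp only [mul_assoc]
      rw [h 3 0, mul_neg, mul_neg, ← mul_assoc (δ 2) (δ 0), h 2 0, neg_mul, mul_neg, neg_neg,
        mul_assoc (δ 0) (δ 2), ← mul_assoc (δ 1) (δ 0), h 1 0, neg_mul, neg_neg, mul_assoc]
    have h5 := congrArg Matrix.trace h1
    rw [Matrix.trace_neg, Matrix.trace_mul_comm (δ 1 * δ 2 * δ 3)] at h5
    have h6 := self_eq_neg.1 h5
    simpa only [mul_assoc] using h6
  rw [vacuumProj_eq, Matrix.trace_smul, Matrix.trace_sub, Matrix.trace_sub, Matrix.trace_sub,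
    Matrix.trace_smul, Matrix.trace_smul, h2 0 1 (by decide), h2 2 3 (by decide), h4]
  simp

/-- Since `i⁻² = i²`, the chirality factors as `(i δ_0 δ_1) (i δ_2 δ_3)`. Vanishing occupation means
that each factor acts as `-1`. -/
theorem IsEuclideanClifford.chirality_mul_vacuumProj (hδ : IsEuclideanClifford δ) :
    ((Complex.I ^ 2)⁻¹ • (δ 0 * δ 1 * δ 2 * δ 3)) * vacuumProj δ = vacuumProj δ := by
  have h1 : Complex.I • (δ 0 * δ 1) * spinProj (δ 0) (δ 1) false =
      -spinProj (δ 0) (δ 1) false := by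
    have h := spinNumber_mul_spinProj (hδ.mul_self 0) (hδ.mul_self 1)
      (hδ.mul_comm_neg (by decide)) false
    rw [Bool.toNat_false, Nat.cast_zero, zero_smul, spinNumber, smul_mul_assoc, add_mul, one_mul,
      smul_eq_zero_iff_right (by norm_num)] at h
    exact eq_neg_of_add_eq_zero_right h
  have h2 : Complex.I • (δ 2 * δ 3) * spinProj (δ 2) (δ 3) false =
      -spinProj (δ 2) (δ 3) false := by
    have h := spinNumber_mul_spinProj (hδ.mul_self 2) (hδ.mul_self 3)
      (hδ.mul_comm_neg (by decide)) false
    rw [Bool.toNat_false, Nat.cast_zero, zero_smul, spinNumber, smul_mul_assoc, add_mul, one_mul,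
      smul_eq_zero_iff_right (by norm_num)] at h
    exact eq_neg_of_add_eq_zero_right h
  have h3 : Commute (Complex.I • (δ 2 * δ 3)) (spinProj (δ 0) (δ 1) false) := by
    refine Commute.smul_left ?_ _
    refine (Commute.one_right _).sub_right (Commute.smul_right ?_ _)
    exact (Commute.one_right _).add_right (hδ.commute_mul.symm.smul_right _)
  have h4 : (Complex.I ^ 2)⁻¹ • (δ 0 * δ 1 * δ 2 * δ 3) =
      (Complex.I • (δ 0 * δ 1)) * (Complex.I • (δ 2 * δ 3)) := by
    rw [smul_mul_smul_comm, Complex.I_mul_I, Complex.I_sq, inv_neg, inv_one]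
    congr 1
    noncomm_ring
  rw [h4, vacuumProj, h3.mul_mul_mul_comm, h1, h2, neg_mul_neg]

end Clifford

/-! ### Ladder operator algebra -/

section Ladder

theorem anticommute_mul {R : Type*} [Ring R] {s u A B : R} (hsu : s * u = -(u * s)) (hAB : Commute A B)
    (hsB : Commute s B) (huA : Commute u A) : s * A * (u * B) = -(u * B * (s * A)) := by
  rw [huA.symm.mul_mul_mul_comm, hsB.symm.mul_mul_mul_comm, hsu, hAB.eq, neg_mul]

variable {R : Type*} [Ring R] [Algebra ℂ R]

/-- The cross terms collapse to the commutator of `D` and `X` and leave `i w s t`. Normal ordering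
`w² X² - D²` produces the constant `w`; together these make up twice `w` times the spin occupation
number. -/
theorem sq_mul_add_mul {s t X D : R} (hs : s * s = 1) (ht : t * t = 1) (hst : s * t = -(t * s))
    (hsX : Commute s X) (hsD : Commute s D) (htX : Commute t X) (htD : Commute t D)
    (hDX : D * X = X * D + 1) (w : ℂ) :
    (s * (w • X) + t * (-Complex.I • D)) * (s * (w • X) + t * (-Complex.I • D)) =
      (w • X - D) * (w • X + D) + w • (1 + Complex.I • (s * t)) := by
  have h1 : s * X * (s * X) = X * X := by rw [hsX.symm.mul_mul_mul_comm, hs, one_mul]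
  have h2 : t * D * (t * D) = D * D := by rw [htD.symm.mul_mul_mul_comm, ht, one_mul]
  have h3 : s * X * (t * D) = s * t * (X * D) := htX.symm.mul_mul_mul_comm _ _
  have h4 : t * D * (s * X) = -(s * t * (X * D)) - s * t := by
    rw [hsD.symm.mul_mul_mul_comm, hDX, hst]
    noncomm_ring
  simp only [mul_smul_comm, smul_mul_assoc, mul_add, add_mul, sub_mul, h1, h2, h3, h4, hDX,
    smul_smul, smul_add, smul_sub, smul_neg]
  match_scalars <;> first | ring1 | linear_combination Complex.I_mul_I

theorem lower_mul_raise {X D : R} (hDX : D * X = X * D + 1) (w : ℂ) :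
    (w • X + D) * (w • X - D) = (w • X - D) * (w • X + D) + (2 * w) • 1 := by
  simp only [mul_smul_comm, smul_mul_assoc, mul_add, add_mul, sub_mul, mul_sub, hDX, smul_add]
  module

/-- The commutator with `A` acts on powers of `B` as `c` times differentiation. At `m = 0` the
truncated exponent is harmless because its coefficient vanishes. -/
theorem lower_mul_raise_pow {A B : R} {c : ℂ} (h : A * B = B * A + c • 1) (m : ℕ) :
    A * B ^ m = B ^ m * A + (m * c) • B ^ (m - 1) := by
  induction m with
  | zero => simp
  | succ m ih =>
    rw [pow_succ, ← mul_assoc, ih, add_mul, mul_assoc, h, mul_add, ← mul_assoc, mul_smul_comm,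
      mul_one, smul_mul_assoc, Nat.add_sub_cancel]
    rcases m with _ | m
    · simp
    · rw [Nat.add_sub_cancel, ← pow_succ B m, Nat.cast_succ (m + 1)]
      module

theorem raise_mul_lower_mul_raise_pow {A B : R} {c : ℂ} (h : A * B = B * A + c • 1) (m : ℕ) :
    B * A * B ^ m = B ^ m * (B * A) + (m * c) • B ^ m := by
  rw [mul_assoc, lower_mul_raise_pow h, mul_add, ← mul_assoc, ← pow_succ', pow_succ, mul_assoc,
    mul_smul_comm]
  rcases m with _ | m
  · simp
  · rw [Nat.add_sub_cancel, ← pow_succ']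

end Ladder

/-! ### The square of the oscillator Dirac operator -/

section Oscillator

variable (δ : Fin 4 → Matrix (Fin 4) (Fin 4) ℂ) (w : Fin 2 → ℝ) (e : OrthonormalBasis (Fin 2) ℝ Plane)

/-- The Dirac operator of a pair of oscillators with frequencies `w` along the axes `e`. -/
def oscDirac : SchwartzOp :=
  spin (δ 0) * ((w 0 : ℂ) • posAlong (e 0)) + spin (δ 1) * (-Complex.I • derivAlong (e 0)) +
    (spin (δ 2) * ((w 1 : ℂ) • posAlong (e 1)) + spin (δ 3) * (-Complex.I • derivAlong (e 1)))

/-- Creation operators. -/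
def raise (j : Fin 2) : SchwartzOp := (w j : ℂ) • posAlong (e j) - derivAlong (e j)

/-- Annihilation operators. -/
def lower (j : Fin 2) : SchwartzOp := (w j : ℂ) • posAlong (e j) + derivAlong (e j)

variable {δ w e}

theorem commute_derivAlong_posAlong {j k : Fin 2} (hjk : j ≠ k) :
    Commute (derivAlong (e j)) (posAlong (e k)) := by
  change _ * _ = _ * _
  rw [derivAlong_mul_posAlong, e.orthonormal.inner_eq_zero hjk.symm]
  simp

theorem derivAlong_mul_posAlong_self (j : Fin 2) :
    derivAlong (e j) * posAlong (e j) = posAlong (e j) * derivAlong (e j) + 1 := by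
  rw [derivAlong_mul_posAlong, real_inner_self_eq_norm_sq, e.orthonormal.norm_eq_one]
  simp

theorem lower_mul_raise_self (j : Fin 2) :
    lower w e j * raise w e j = raise w e j * lower w e j + (2 * w j : ℂ) • 1 :=
  lower_mul_raise (derivAlong_mul_posAlong_self j) _

theorem commute_ladder {j k : Fin 2} (hjk : j ≠ k) {S T : SchwartzOp}
    (hS : S = raise w e j ∨ S = lower w e j) (hT : T = raise w e k ∨ T = lower w e k) :
    Commute S T := by
  have hX : Commute ((w j : ℂ) • posAlong (e j)) ((w k : ℂ) • posAlong (e k)) :=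
    ((commute_posAlong _ _).smul_left _).smul_right _
  have hXD : Commute ((w j : ℂ) • posAlong (e j)) (derivAlong (e k)) :=
    (commute_derivAlong_posAlong hjk.symm).symm.smul_left _
  have hDX : Commute (derivAlong (e j)) ((w k : ℂ) • posAlong (e k)) :=
    (commute_derivAlong_posAlong hjk).smul_right _
  have hD := commute_derivAlong (e j) (e k)
  rcases hS with rfl | rfl <;> rcases hT with rfl | rfl
  · exact (hX.sub_right hXD).sub_left (hDX.sub_right hD)
  · exact (hX.add_right hXD).sub_left (hDX.add_right hD)
  · exact (hX.sub_right hXD).add_left (hDX.sub_right hD)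
  · exact (hX.add_right hXD).add_left (hDX.add_right hD)

theorem commute_spin_ladder (M : Matrix (Fin 4) (Fin 4) ℂ) (j : Fin 2) :
    Commute (spin M) (raise w e j) ∧ Commute (spin M) (lower w e j) :=
  ⟨((commute_spin_posAlong M _).smul_right _).sub_right (commute_spin_derivAlong M _),
    ((commute_spin_posAlong M _).smul_right _).add_right (commute_spin_derivAlong M _)⟩

theorem spin_spinNumber (s t : Matrix (Fin 4) (Fin 4) ℂ) :
    spin (spinNumber s t) = (2⁻¹ : ℂ) • (1 + Complex.I • (spin s * spin t)) := by
  simp only [← spinHom_apply, spinNumber, map_smul, map_add, map_one, map_mul]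

theorem oscDirac_mul_self (hδ : IsEuclideanClifford δ) :
    oscDirac δ w e * oscDirac δ w e =
      (raise w e 0 * lower w e 0 + (2 * w 0 : ℂ) • spin (spinNumber (δ 0) (δ 1))) +
      (raise w e 1 * lower w e 1 + (2 * w 1 : ℂ) • spin (spinNumber (δ 2) (δ 3))) := by
  have hsq (i : Fin 4) : spin (δ i) * spin (δ i) = 1 := by
    simp only [← spinHom_apply, ← map_mul, hδ.mul_self, map_one]
  have hanti (i j : Fin 4) (hij : i ≠ j := by decide) :
      spin (δ i) * spin (δ j) = -(spin (δ j) * spin (δ i)) := by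
    simp only [← spinHom_apply, ← map_mul, ← map_neg, hδ.mul_comm_neg hij]
  have hself (i j : Fin 4) (k : Fin 2) (hij : i ≠ j := by decide) :=
    sq_mul_add_mul (hsq i) (hsq j) (hanti i j hij)
      (commute_spin_posAlong _ (e k)) (commute_spin_derivAlong _ _) (commute_spin_posAlong _ _)
      (commute_spin_derivAlong _ _) (derivAlong_mul_posAlong_self (e := e) k) (w k)
  have h0 := hself 0 1 0
  have h1 := hself 2 3 1
  have hX (M) (k : Fin 2) : Commute (spin M) ((w k : ℂ) • posAlong (e k)) :=
    (commute_spin_posAlong _ _).smul_right _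
  have hD (M) (k : Fin 2) : Commute (spin M) (-Complex.I • derivAlong (e k)) :=
    (commute_spin_derivAlong _ _).smul_right _
  have c1 := anticommute_mul (hanti 0 2)
    (((commute_posAlong (e 0) (e 1)).smul_left (w 0 : ℂ)).smul_right (w 1 : ℂ)) (hX _ _) (hX _ _)
  have c2 := anticommute_mul (hanti 0 3)
    (((commute_derivAlong_posAlong (e := e) (j := 1) (k := 0) (by decide)).symm.smul_left
      (w 0 : ℂ)).smul_right (-Complex.I)) (hD _ _) (hX _ _)
  have c3 := anticommute_mul (hanti 1 2)
    (((commute_derivAlong_posAlong (e := e) (j := 0) (k := 1) (by decide)).smul_left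
      (-Complex.I)).smul_right (w 1 : ℂ)) (hX _ _) (hD _ _)
  have c4 := anticommute_mul (hanti 1 3)
    (((commute_derivAlong (e 0) (e 1)).smul_left (-Complex.I)).smul_right (-Complex.I))
    (hD _ _) (hD _ _)
  -- The terms of different blocks anticommute, their spin factors anticommuting and their orbital
  -- factors commuting, so the mixed products cancel in the square.
  have key : ∀ P P' Q Q' : SchwartzOp, P * Q = -(Q * P) → P * Q' = -(Q' * P) →
      P' * Q = -(Q * P') → P' * Q' = -(Q' * P') →
      (P + P' + (Q + Q')) * (P + P' + (Q + Q')) =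
        (P + P') * (P + P') + (Q + Q') * (Q + Q') := by
    intro P P' Q Q' h1 h2 h3 h4
    simp only [mul_add, add_mul, h1, h2, h3, h4]
    abel
  rw [oscDirac, key _ _ _ _ c1 c2 c3 c4, h0, h1, spin_spinNumber, spin_spinNumber, raise, raise,
    lower, lower, smul_smul, smul_smul]
  congr 3 <;> ring

theorem oscDirac_mul_self_mul_raise_pow (hδ : IsEuclideanClifford δ) (m n : ℕ) :
    oscDirac δ w e * oscDirac δ w e * (raise w e 0 ^ m * raise w e 1 ^ n) =
      raise w e 0 ^ m * raise w e 1 ^ n *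
        (oscDirac δ w e * oscDirac δ w e + (2 * w 0 * m + 2 * w 1 * n : ℂ) • 1) := by
  have h01 : (0 : Fin 2) ≠ 1 := by decide
  have hN0 := raise_mul_lower_mul_raise_pow (lower_mul_raise_self (w := w) (e := e) 0) m
  have hN1 := raise_mul_lower_mul_raise_pow (lower_mul_raise_self (w := w) (e := e) 1) n
  have c0 : Commute (raise w e 0 * lower w e 0) (raise w e 1 ^ n) :=
    ((commute_ladder h01 (.inl rfl) (.inl rfl)).mul_left
      (commute_ladder h01 (.inr rfl) (.inl rfl))).pow_right n
  have c1 : Commute (raise w e 1 * lower w e 1) (raise w e 0 ^ m) :=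
    ((commute_ladder h01.symm (.inl rfl) (.inl rfl)).mul_left
      (commute_ladder h01.symm (.inr rfl) (.inl rfl))).pow_right m
  have cs : ∀ M, Commute (spin M) (raise w e 0 ^ m * raise w e 1 ^ n) := fun M =>
    ((commute_spin_ladder M 0).1.pow_right m).mul_right ((commute_spin_ladder M 1).1.pow_right n)
  have e0 : raise w e 0 * lower w e 0 * (raise w e 0 ^ m * raise w e 1 ^ n) =
      raise w e 0 ^ m * raise w e 1 ^ n * (raise w e 0 * lower w e 0) +
        (m * (2 * w 0) : ℂ) • (raise w e 0 ^ m * raise w e 1 ^ n) := by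
    rw [← mul_assoc, hN0, add_mul, smul_mul_assoc, mul_assoc (raise w e 0 ^ m), c0.eq, mul_assoc]
  have e1 : raise w e 1 * lower w e 1 * (raise w e 0 ^ m * raise w e 1 ^ n) =
      raise w e 0 ^ m * raise w e 1 ^ n * (raise w e 1 * lower w e 1) +
        (n * (2 * w 1) : ℂ) • (raise w e 0 ^ m * raise w e 1 ^ n) := by
    rw [← mul_assoc, c1.eq, mul_assoc, hN1, mul_add, mul_smul_comm, mul_assoc (raise w e 0 ^ m)]
  rw [oscDirac_mul_self hδ]
  simp only [add_mul, mul_add, smul_mul_assoc, mul_smul_comm, e0, e1, (cs _).eq, mul_one]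
  module

end Oscillator

/-! ### Ground states and excited states -/

section Vacuum

variable (w : Fin 2 → ℝ) (e : OrthonormalBasis (Fin 2) ℝ Plane)

/-- The exponent of the ground state of a pair of oscillators. -/
def oscExponent (q : Plane) : ℝ := w 0 / 2 * ⟪e 0, q⟫_ℝ ^ 2 + w 1 / 2 * ⟪e 1, q⟫_ℝ ^ 2

theorem hasTemperateGrowth_oscExponent : (oscExponent w e).HasTemperateGrowth := by
  have h : ∀ j, (fun q : Plane => w j / 2 * ⟪e j, q⟫_ℝ ^ 2).HasTemperateGrowth := fun j =>
    (Function.HasTemperateGrowth.const _).mul ((innerSL ℝ (e j)).hasTemperateGrowth.pow 2)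
  exact (h 0).add (h 1)

theorem le_oscExponent (q : Plane) : min (w 0) (w 1) / 2 * ‖q‖ ^ 2 ≤ oscExponent w e q := by
  have h := e.sum_sq_norm_inner_right q
  rw [Fin.sum_univ_two, Real.norm_eq_abs, Real.norm_eq_abs, sq_abs, sq_abs] at h
  rw [← h, oscExponent, mul_add]
  gcongr
  · exact min_le_left _ _
  · exact min_le_right _ _

theorem oscExponent_add_smul (j : Fin 2) (q : Plane) (t : ℝ) :
    oscExponent w e (q + t • e j) =
      oscExponent w e q + w j * ⟪e j, q⟫_ℝ * t + w j / 2 * t ^ 2 := by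
  have h01 : ⟪e 0, e 1⟫_ℝ = 0 := e.orthonormal.inner_eq_zero (by decide)
  have h10 : ⟪e 1, e 0⟫_ℝ = 0 := e.orthonormal.inner_eq_zero (by decide)
  fin_cases j <;> simp [oscExponent, inner_add_right, real_inner_smul_right, h01, h10] <;> ring

variable {w} (hw : ∀ j, 0 < w j)

theorem half_min_pos (hw : ∀ j, 0 < w j) : 0 < min (w 0) (w 1) / 2 :=
  half_pos (lt_min (hw 0) (hw 1))

/-- The oscillator ground states. -/
def vacuum : Spinor →ₗ[ℂ] 𝓢(Plane, Spinor) where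
  toFun := gaussSpinor (hasTemperateGrowth_oscExponent w e) (half_min_pos hw) (le_oscExponent w e)
  map_add' u v := by
    ext q : 1
    simp [gaussSpinor_apply]
  map_smul' a v := by
    ext q : 1
    simp only [gaussSpinor_apply, RingHom.id_apply, smul_apply]
    exact smul_comm _ _ _

theorem vacuum_apply (v : Spinor) (q : Plane) :
    vacuum e hw v q = (Real.exp (-oscExponent w e q) : ℂ) • v := gaussSpinor_apply _ _ _ v q

theorem vacuum_injective : Function.Injective (vacuum e hw) := by
  intro u v h
  have h0 := congrArg (fun φ : 𝓢(Plane, Spinor) => φ 0) h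
  simp only [vacuum_apply] at h0
  exact smul_right_injective _ (by exact_mod_cast (Real.exp_pos _).ne') h0

theorem spin_vacuum (M : Matrix (Fin 4) (Fin 4) ℂ) (v : Spinor) :
    spin M (vacuum e hw v) = vacuum e hw (Matrix.toEuclideanCLM (𝕜 := ℂ) M v) := by
  ext q : 1
  rw [spin_apply, vacuum_apply, vacuum_apply, map_smul]

/-- Differentiating the Gaussian along `e j` gives the factor `-w j ⟪e j, q⟫`, which the position
term compensates. -/
theorem lower_vacuum (j : Fin 2) (v : Spinor) : lower w e j (vacuum e hw v) = 0 := by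
  ext q : 1
  have h : HasLineDerivAt ℝ (vacuum e hw v) (-((w j * ⟪e j, q⟫_ℝ : ℝ) : ℂ) • vacuum e hw v q) q
      (e j) := by
    have h1 : HasDerivAt (fun t : ℝ => -oscExponent w e (q + t • e j)) (-(w j * ⟪e j, q⟫_ℝ)) 0 := by
      simp only [oscExponent_add_smul]
      have := ((((hasDerivAt_id (0 : ℝ)).const_mul (w j * ⟪e j, q⟫_ℝ)).const_add
        (oscExponent w e q)).add (((hasDerivAt_id (0 : ℝ)).pow 2).const_mul (w j / 2))).neg
      exact this.congr_deriv (by simp)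
    have h2 := (h1.exp.ofReal_comp).smul_const v
    simp only [zero_smul, add_zero] at h2
    have h3 : (fun t : ℝ => vacuum e hw v (q + t • e j)) =
        fun t => ((Real.exp (-oscExponent w e (q + t • e j)) : ℝ) : ℂ) • v := by
      ext1 t
      exact vacuum_apply _ _ _ _
    rw [HasLineDerivAt, h3]
    convert h2 using 1
    rw [vacuum_apply, smul_smul]
    push_cast
    ring_nf
  have h4 := (h.unique ((vacuum e hw v).differentiableAt.hasFDerivAt.hasLineDerivAt (e j))).symm
  simp only [lower, add_apply, smul_apply, derivAlong_apply, posAlong_apply, h4,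
    zero_apply]
  rw [smul_smul]
  push_cast
  module

/-- Polynomials in the creation operators, applied to the ground states. -/
def excited (δ : Fin 4 → Matrix (Fin 4) (Fin 4) ℂ) (k : ℕ × ℕ × Bool × Bool × Fin 4) :
    𝓢(Plane, Spinor) :=
  (raise w e 0 ^ k.1 * raise w e 1 ^ k.2.1) (vacuum e hw (Matrix.toEuclideanCLM (𝕜 := ℂ)
    (spinProj (δ 0) (δ 1) k.2.2.1 * spinProj (δ 2) (δ 3) k.2.2.2.1)
    (EuclideanSpace.single k.2.2.2.2 1)))

variable (w) in
/-- The eigenvalues of the squared Dirac operator. -/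
def energy (k : ℕ × ℕ × Bool × Bool × Fin 4) : ℝ :=
  2 * w 0 * (k.1 + k.2.2.1.toNat : ℕ) + 2 * w 1 * (k.2.1 + k.2.2.2.1.toNat : ℕ)

variable {δ : Fin 4 → Matrix (Fin 4) (Fin 4) ℂ} {e}

theorem oscDirac_oscDirac_excited (hδ : IsEuclideanClifford δ)
    (k : ℕ × ℕ × Bool × Bool × Fin 4) :
    oscDirac δ w e (oscDirac δ w e (excited e hw δ k)) = (energy w k : ℂ) • excited e hw δ k := by
  obtain ⟨m, n, ε, ε', i⟩ := k
  set φ := vacuum e hw (Matrix.toEuclideanCLM (𝕜 := ℂ)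
    (spinProj (δ 0) (δ 1) ε * spinProj (δ 2) (δ 3) ε') (EuclideanSpace.single i 1)) with hφ
  have h0 : spin (spinNumber (δ 0) (δ 1)) φ = (ε.toNat : ℂ) • φ := by
    rw [hφ, spin_vacuum, ← mul_apply_eq_comp, ← map_mul, ← mul_assoc,
      spinNumber_mul_spinProj (hδ.mul_self 0) (hδ.mul_self 1) (hδ.mul_comm_neg (by decide)),
      smul_mul_assoc, map_smul, smul_apply, map_smul]
  have h1 : spin (spinNumber (δ 2) (δ 3)) φ = (ε'.toNat : ℂ) • φ := by
    rw [hφ, spin_vacuum, ← mul_apply_eq_comp, ← map_mul, (hδ.commute_spinProj ε ε').eq, ← mul_assoc,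
      spinNumber_mul_spinProj (hδ.mul_self 2) (hδ.mul_self 3) (hδ.mul_comm_neg (by decide)),
      smul_mul_assoc, map_smul, smul_apply, map_smul]
  have h := congrArg (fun S : SchwartzOp => S φ) (oscDirac_mul_self_mul_raise_pow (w := w) (e := e)
    hδ m n)
  simp only [mul_apply_eq_comp] at h
  have h2 : (oscDirac δ w e * oscDirac δ w e + (2 * w 0 * m + 2 * w 1 * n : ℂ) • 1 : SchwartzOp) φ =
      (energy w (m, n, ε, ε', i) : ℂ) • φ := by
    rw [oscDirac_mul_self hδ]
    simp only [add_apply, mul_apply_eq_comp, smul_apply, hφ, lower_vacuum, map_zero]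
    rw [← hφ, h0, h1, energy, one_apply_eq_self]
    push_cast
    module
  rw [h2, map_smul, map_smul] at h
  simpa only [excited, mul_apply_eq_comp] using h

end Vacuum

/-! ### Totality, energies and the ground state -/

section Total

/-- The linear span of the excited states. -/
def excitedSpan {w : Fin 2 → ℝ} (e : OrthonormalBasis (Fin 2) ℝ Plane) (hw : ∀ j, 0 < w j)
    (δ : Fin 4 → Matrix (Fin 4) (Fin 4) ℂ) : Submodule ℂ 𝓢(Plane, Spinor) :=
  Submodule.span ℂ (Set.range (excited e hw δ))

variable {δ : Fin 4 → Matrix (Fin 4) (Fin 4) ℂ} {w : Fin 2 → ℝ}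
  {e : OrthonormalBasis (Fin 2) ℝ Plane} (hw : ∀ j, 0 < w j)

theorem raise_pow_vacuum_mem_span (m n : ℕ) (v : Spinor) :
    (raise w e 0 ^ m * raise w e 1 ^ n) (vacuum e hw v) ∈
      excitedSpan e hw δ := by
  have h : ∀ (ε ε' : Bool) (v : Spinor), (raise w e 0 ^ m * raise w e 1 ^ n) (vacuum e hw
      (Matrix.toEuclideanCLM (𝕜 := ℂ) (spinProj (δ 0) (δ 1) ε * spinProj (δ 2) (δ 3) ε') v)) ∈
      excitedSpan e hw δ := by
    intro ε ε' v
    let L : Spinor →ₗ[ℂ] 𝓢(Plane, Spinor) :=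
      (raise w e 0 ^ m * raise w e 1 ^ n : SchwartzOp).toLinearMap ∘ₗ vacuum e hw ∘ₗ
        (Matrix.toEuclideanCLM (𝕜 := ℂ)
          (spinProj (δ 0) (δ 1) ε * spinProj (δ 2) (δ 3) ε')).toLinearMap
    change v ∈ (excitedSpan e hw δ).comap L
    have htop : (⊤ : Submodule ℂ Spinor) ≤
        (excitedSpan e hw δ).comap L := by
      rw [← (EuclideanSpace.basisFun (Fin 4) ℂ).toBasis.span_eq, Submodule.span_le]
      rintro _ ⟨i, rfl⟩
      refine Submodule.subset_span ⟨(m, n, ε, ε', i), ?_⟩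
      rw [OrthonormalBasis.coe_toBasis, EuclideanSpace.basisFun_apply]
      rfl
    exact htop Submodule.mem_top
  -- The four products of spin projections sum to the identity, so every spinor splits into parts of
  -- definite occupation.
  have h1 : v = ∑ ε : Bool, ∑ ε' : Bool, Matrix.toEuclideanCLM (𝕜 := ℂ)
      (spinProj (δ 0) (δ 1) ε * spinProj (δ 2) (δ 3) ε') v := by
    have h2 := congrArg (fun M => Matrix.toEuclideanCLM (𝕜 := ℂ) M v)
      (congrArg₂ (· * ·) (spinProj_add (δ 0) (δ 1)) (spinProj_add (δ 2) (δ 3)))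
    simp only [add_mul, mul_add, mul_one, map_add, map_one, add_apply, one_apply_eq_self] at h2
    rw [Fintype.sum_bool, Fintype.sum_bool, Fintype.sum_bool]
    refine h2.symm.trans ?_
    abel
  rw [h1]
  simp only [map_sum]
  exact sum_mem fun ε _ => sum_mem fun ε' _ => h ε ε' v

theorem raise_mem_span (j : Fin 2) {φ : 𝓢(Plane, Spinor)}
    (hφ : φ ∈ excitedSpan e hw δ) :
    raise w e j φ ∈ excitedSpan e hw δ := by
  refine (Submodule.span_le (p := (excitedSpan e hw δ).comap
    (raise w e j).toLinearMap)).2 ?_ hφ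
  rintro _ ⟨k, rfl⟩
  change raise w e j (excited e hw δ k) ∈ excitedSpan e hw δ
  rw [excited, ← mul_apply_eq_comp]
  fin_cases j
  · change (raise w e 0 * _) _ ∈ excitedSpan e hw δ
    rw [← mul_assoc, ← pow_succ']
    exact raise_pow_vacuum_mem_span hw _ _ _
  · change (raise w e 1 * _) _ ∈ excitedSpan e hw δ
    rw [← mul_assoc, ((commute_ladder (show (1 : Fin 2) ≠ 0 by decide) (.inl rfl)
      (.inl rfl)).pow_right _).eq, mul_assoc, ← pow_succ']
    exact raise_pow_vacuum_mem_span hw _ _ _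

theorem lower_mem_span (j : Fin 2) {φ : 𝓢(Plane, Spinor)}
    (hφ : φ ∈ excitedSpan e hw δ) :
    lower w e j φ ∈ excitedSpan e hw δ := by
  refine (Submodule.span_le (p := (excitedSpan e hw δ).comap
    (lower w e j).toLinearMap)).2 ?_ hφ
  rintro _ ⟨k, rfl⟩
  change lower w e j (excited e hw δ k) ∈ excitedSpan e hw δ
  rw [excited, ← mul_apply_eq_comp]
  fin_cases j
  · change (lower w e 0 * _) _ ∈ excitedSpan e hw δ
    rw [← mul_assoc, lower_mul_raise_pow (lower_mul_raise_self 0), add_mul, mul_assoc,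
      ((commute_ladder (show (0 : Fin 2) ≠ 1 by decide) (.inr rfl) (.inl rfl)).pow_right _).eq,
      smul_mul_assoc, add_apply, mul_apply_eq_comp, mul_apply_eq_comp, lower_vacuum, map_zero,
      map_zero, zero_add, smul_apply]
    exact Submodule.smul_mem _ _ (raise_pow_vacuum_mem_span hw _ _ _)
  · change (lower w e 1 * _) _ ∈ excitedSpan e hw δ
    rw [← mul_assoc, ((commute_ladder (show (1 : Fin 2) ≠ 0 by decide) (.inr rfl)
      (.inl rfl)).pow_right _).eq, mul_assoc, lower_mul_raise_pow (lower_mul_raise_self 1), mul_add,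
      mul_smul_comm, add_apply, mul_apply_eq_comp, mul_apply_eq_comp, lower_vacuum, map_zero,
      map_zero, zero_add, smul_apply]
    exact Submodule.smul_mem _ _ (raise_pow_vacuum_mem_span hw _ _ _)

/-- Each normal coordinate is a multiple of the sum of a creation and an annihilation operator. The
span is therefore stable under multiplication by coordinates and contains all powers of linear forms
times the ground states. -/
theorem posAlong_mem_span (q : Plane) {φ : 𝓢(Plane, Spinor)}
    (hφ : φ ∈ excitedSpan e hw δ) :
    posAlong q φ ∈ excitedSpan e hw δ := by
  have h : ∀ j, posAlong (e j) φ ∈ excitedSpan e hw δ := fun j => by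
    have h1 : posAlong (e j) φ = (2 * w j : ℂ)⁻¹ • (raise w e j φ + lower w e j φ) := by
      have hwj : (w j : ℂ) ≠ 0 := by exact_mod_cast (hw j).ne'
      simp only [raise, lower, sub_apply, add_apply, smul_apply]
      match_scalars <;> field_simp <;> ring
    rw [h1]
    exact Submodule.smul_mem _ _ (add_mem (raise_mem_span hw j hφ) (lower_mem_span hw j hφ))
  rw [← e.sum_repr' q, Fin.sum_univ_two, posAlong_add, posAlong_smul, posAlong_smul, add_apply,
    smul_apply, smul_apply]
  exact add_mem (Submodule.smul_mem _ _ (h 0)) (Submodule.smul_mem _ _ (h 1))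

/-- The excited states are total. -/
theorem eq_zero_of_inner_excited {ψ : SpinorL2}
    (h : ∀ k, ⟪incl (excited e hw δ k), ψ⟫_ℂ = 0) : ψ = 0 := by
  have hspan : ∀ φ ∈ excitedSpan e hw δ, ⟪incl φ, ψ⟫_ℂ = 0 := by
    intro φ hφ
    induction hφ using Submodule.span_induction with
    | mem _ hx =>
      obtain ⟨k, rfl⟩ := hx
      exact h k
    | zero => simp
    | add _ _ _ _ h1 h2 => rw [map_add, inner_add_left, h1, h2, add_zero]
    | smul a _ _ h1 => rw [map_smul, inner_smul_left, h1, mul_zero]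
  refine eq_zero_of_inner_posAlong_pow_gaussSpinor (hasTemperateGrowth_oscExponent w e)
    (half_min_pos hw) (le_oscExponent w e) fun q n v => hspan _ ?_
  induction n with
  | zero => simpa [vacuum] using raise_pow_vacuum_mem_span (e := e) (δ := δ) hw 0 0 v
  | succ n ih =>
    rw [pow_succ', mul_apply_eq_comp]
    exact posAlong_mem_span hw q ih

theorem energy_nonneg (hw : ∀ j, 0 < w j) (k : ℕ × ℕ × Bool × Bool × Fin 4) : 0 ≤ energy w k := by
  have h0 := hw 0
  have h1 := hw 1
  rw [energy]
  positivity

theorem finite_energy_le (hw : ∀ j, 0 < w j) (R : ℝ) :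
    {k | |energy w k| ≤ R}.Finite := by
  obtain ⟨N, hN⟩ := exists_nat_gt (R / (2 * w 0))
  obtain ⟨N', hN'⟩ := exists_nat_gt (R / (2 * w 1))
  refine ((Set.finite_Iic N).prod ((Set.finite_Iic N').prod Set.finite_univ)).subset ?_
  rintro ⟨m, n, ε, ε', i⟩ hk
  have h0 := hw 0
  have h1 := hw 1
  rw [Set.mem_ofPred_eq, abs_of_nonneg (energy_nonneg hw _), energy] at hk
  push_cast at hk
  rw [div_lt_iff₀ (by positivity)] at hN hN'
  have p1 : 0 ≤ 2 * w 0 * (ε.toNat : ℝ) := by positivity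
  have p2 : 0 ≤ 2 * w 1 * (ε'.toNat : ℝ) := by positivity
  have p3 : 0 ≤ 2 * w 0 * (m : ℝ) := by positivity
  have p4 : 0 ≤ 2 * w 1 * (n : ℝ) := by positivity
  refine ⟨?_, ?_, Set.mem_univ _⟩
  · have : (m : ℝ) < N := by
      refine lt_of_mul_lt_mul_left (a := 2 * w 0) ?_ (by positivity)
      linarith
    exact_mod_cast this.le
  · have : (n : ℝ) < N' := by
      refine lt_of_mul_lt_mul_left (a := 2 * w 1) ?_ (by positivity)
      linarith
    exact_mod_cast this.le

/-- A nonzero energy is at least twice the smaller frequency, so that frequency lies in the gap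
above `0`. It becomes the radius of an admissible circle. -/
theorem energy_ne_min (hw : ∀ j, 0 < w j) (k : ℕ × ℕ × Bool × Bool × Fin 4) :
    energy w k ≠ min (w 0) (w 1) := by
  have h0 := hw 0
  have h1 := hw 1
  rw [energy]
  generalize k.1 + k.2.2.1.toNat = m
  generalize k.2.1 + k.2.2.2.1.toNat = n
  intro h
  have hm := min_le_left (w 0) (w 1)
  have hn := min_le_right (w 0) (w 1)
  have hpos := lt_min h0 h1
  have p3 : 0 ≤ 2 * w 0 * (m : ℝ) := by positivity
  have p4 : 0 ≤ 2 * w 1 * (n : ℝ) := by positivity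
  rcases Nat.eq_zero_or_pos m with rfl | hm'
  · rcases Nat.eq_zero_or_pos n with rfl | hn'
    · simp only [Nat.cast_zero, mul_zero, add_zero] at h
      exact hpos.ne h
    · have : (1 : ℝ) ≤ n := by exact_mod_cast hn'
      nlinarith
  · have : (1 : ℝ) ≤ m := by exact_mod_cast hm'
    nlinarith

theorem energy_eq_zero_iff (hw : ∀ j, 0 < w j) (k : ℕ × ℕ × Bool × Bool × Fin 4) :
    energy w k = 0 ↔ ∃ i, k = (0, 0, false, false, i) := by
  obtain ⟨m, n, ε, ε', i⟩ := k
  have h0 := hw 0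
  have h1 := hw 1
  rw [energy, add_eq_zero_iff_of_nonneg (by positivity) (by positivity)]
  cases ε <;> cases ε' <;> simp [h0.ne', h1.ne', Nat.cast_add_one_ne_zero]

theorem excited_ground (i : Fin 4) : excited e hw δ (0, 0, false, false, i) =
    vacuum e hw (Matrix.toEuclideanCLM (𝕜 := ℂ) (vacuumProj δ) (EuclideanSpace.single i 1)) := by
  simp [excited, vacuumProj]

/-- The ground states are the injective image of the range of `vacuumProj`, and the rank of an
idempotent is its trace. The four spanning vectors are thus multiples of a single one. -/
theorem finrank_span_ground (hδ : IsEuclideanClifford δ) :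
    Module.finrank ℂ (Submodule.span ℂ
      ((fun k => incl (excited e hw δ k)) '' {k | (energy w k : ℂ) = 0})) = 1 := by
  set L : Spinor →ₗ[ℂ] Spinor := Matrix.toEuclideanLin (vacuumProj δ) with hL
  have h1 : (fun k => incl (excited e hw δ k)) '' {k | (energy w k : ℂ) = 0} =
      ((incl ∘ₗ vacuum e hw) ∘ₗ L) '' Set.range (EuclideanSpace.basisFun (Fin 4) ℂ).toBasis := by
    ext ψ
    simp only [Set.mem_image, Set.mem_ofPred_eq, Complex.ofReal_eq_zero, energy_eq_zero_iff hw,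
      Set.mem_range]
    constructor
    · rintro ⟨_, ⟨i, rfl⟩, rfl⟩
      refine ⟨_, ⟨i, rfl⟩, ?_⟩
      rw [excited_ground]
      simp [L, ← Matrix.coe_toEuclideanCLM_eq_toEuclideanLin]
    · rintro ⟨_, ⟨i, rfl⟩, rfl⟩
      refine ⟨_, ⟨i, rfl⟩, ?_⟩
      rw [excited_ground]
      simp [L, ← Matrix.coe_toEuclideanCLM_eq_toEuclideanLin]
  have hproj : LinearMap.IsProj (LinearMap.range L) L := by
    refine LinearMap.IsIdempotentElem.isProj_range L ?_
    have := congrArg (Matrix.toEuclideanCLM (n := Fin 4) (𝕜 := ℂ)) hδ.vacuumProj_mul_self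
    rw [map_mul] at this
    ext1 v
    exact congrArg (fun T : Spinor →L[ℂ] Spinor => T v) this
  have htr : LinearMap.trace ℂ Spinor L = 1 := by
    have h := DFunLike.congr_fun (Matrix.toLpLin_eq_toLin (R := ℂ) (m := Fin 4) (n := Fin 4) 2 2)
      (vacuumProj δ)
    rw [hL, h, Matrix.trace_toLin_eq, hδ.trace_vacuumProj]
  rw [hproj.trace] at htr
  have hinj : Function.Injective (incl ∘ₗ vacuum e hw) :=
    incl_injective.comp (vacuum_injective e hw)
  rw [h1, ← Submodule.map_span, Module.Basis.span_eq, Submodule.map_top, LinearMap.range_comp,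
    ← (Submodule.equivMapOfInjective _ hinj _).finrank_eq]
  exact_mod_cast htr

end Total

/-! ### The Dirac operator on its maximal domain -/

section Dirac

variable {δ : Fin 4 → Matrix (Fin 4) (Fin 4) ℂ} {c : ℝ}

theorem diracSchwartz_eq : diracSchwartz δ c =
    spin (δ 0) * (pos 0 - (c : ℂ) • pos 1) + spin (δ 1) * mom 0 - spin (δ 2) * pos 1 -
      spin (δ 3) * mom 1 := by
  ext φ q : 2
  simp [diracSchwartz, Fin.sum_univ_four, braneL, braneR, mul_apply_eq_comp]
  abel

theorem isFormallySymmetric_oscDirac (hδ : IsEuclideanClifford δ) (w : Fin 2 → ℝ)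
    (e : OrthonormalBasis (Fin 2) ℝ Plane) : IsFormallySymmetric (oscDirac δ w e) := by
  have hX (i : Fin 4) (j : Fin 2) :
      IsFormallySymmetric (spin (δ i) * ((w j : ℂ) • posAlong (e j))) :=
    (isFormallySymmetric_spin (hδ.1 i)).mul ((isFormallySymmetric_posAlong _).real_smul _)
      ((commute_spin_posAlong _ _).smul_right _)
  have hD (i : Fin 4) (j : Fin 2) :
      IsFormallySymmetric (spin (δ i) * (-Complex.I • derivAlong (e j))) :=
    (isFormallySymmetric_spin (hδ.1 i)).mul (isFormallySymmetric_derivAlong _)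
      ((commute_spin_derivAlong _ _).smul_right _)
  exact ((hX 0 0).add (hD 1 0)).add ((hX 2 1).add (hD 3 1))

theorem diracMin_apply (φ : 𝓢(Plane, Spinor)) (h : incl φ ∈ (diracMin δ c).domain) :
    diracMin δ c ⟨incl φ, h⟩ = incl (diracSchwartz δ c φ) := by
  change incl (diracSchwartz δ c ((LinearEquiv.ofInjective incl incl_injective).symm ⟨incl φ, h⟩)) =
    _
  congr 2
  rw [LinearEquiv.symm_apply_eq]
  rfl

theorem incl_mem_diracMin_domain (φ : 𝓢(Plane, Spinor)) : incl φ ∈ (diracMin δ c).domain :=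
  ⟨φ, rfl⟩

theorem inner_incl_dirac (φ : 𝓢(Plane, Spinor)) (ψ : (dirac δ c).domain) :
    ⟪incl φ, dirac δ c ψ⟫_ℂ = ⟪incl (diracSchwartz δ c φ), (ψ : SpinorL2)⟫_ℂ := by
  have h : ⟪dirac δ c ψ, incl φ⟫_ℂ =
      ⟪(ψ : SpinorL2), diracMin δ c ⟨incl φ, incl_mem_diracMin_domain φ⟩⟫_ℂ :=
    LinearPMap.adjoint_isFormalAdjoint (dense_diracMin_domain δ c) ψ ⟨incl φ, _⟩
  rw [diracMin_apply] at h
  have h' := congrArg (starRingEnd ℂ) h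
  rw [inner_conj_symm, inner_conj_symm] at h'
  exact h'

/-- A weak equation tested on Schwartz spinors already yields membership in the adjoint domain. All
later domain questions thereby become algebra on Schwartz spinors. -/
theorem exists_dirac_eq {ψ χ : SpinorL2}
    (h : ∀ φ, ⟪incl φ, χ⟫_ℂ = ⟪incl (diracSchwartz δ c φ), ψ⟫_ℂ) :
    ∃ hψ : ψ ∈ (dirac δ c).domain, dirac δ c ⟨ψ, hψ⟩ = χ := by
  have h1 : ∀ x : (diracMin δ c).domain, ⟪χ, (x : SpinorL2)⟫_ℂ = ⟪ψ, diracMin δ c x⟫_ℂ := by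
    rintro ⟨_, φ, rfl⟩
    change ⟪χ, incl φ⟫_ℂ = ⟪ψ, diracMin δ c ⟨incl φ, incl_mem_diracMin_domain φ⟩⟫_ℂ
    rw [diracMin_apply, ← inner_conj_symm, ← inner_conj_symm ψ]
    exact congrArg _ (h φ)
  refine ⟨LinearPMap.mem_adjoint_domain_of_exists _ ⟨χ, h1⟩, ?_⟩
  exact LinearPMap.adjoint_apply_eq (dense_diracMin_domain δ c) _ h1

theorem exists_dirac_incl (hsym : IsFormallySymmetric (diracSchwartz δ c))
    (φ : 𝓢(Plane, Spinor)) : ∃ h : incl φ ∈ (dirac δ c).domain,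
      dirac δ c ⟨incl φ, h⟩ = incl (diracSchwartz δ c φ) :=
  exists_dirac_eq fun χ => (hsym χ φ).symm

theorem incl_mem_eigenspace (hsym : IsFormallySymmetric (diracSchwartz δ c))
    {φ : 𝓢(Plane, Spinor)} {μ : ℂ} (h : diracSchwartz δ c (diracSchwartz δ c φ) = μ • φ) :
    incl φ ∈ eigenspace (sq (dirac δ c)) μ := by
  obtain ⟨h1, h2⟩ := exists_dirac_incl hsym φ
  obtain ⟨h3, h4⟩ := exists_dirac_incl hsym (diracSchwartz δ c φ)
  have h5 : dirac δ c ⟨incl φ, h1⟩ ∈ (dirac δ c).domain := by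
    rw [h2]
    exact h3
  refine mem_eigenspace.2 ⟨mem_sq_domain.2 ⟨h1, h5⟩, ?_⟩
  rw [sq_apply _ h1 h5, ← map_smul, ← h, ← h4]
  congr 1
  exact Subtype.ext h2

/-- Both factors of the square are moved onto `φ` through the adjoint, so `ψ` may be any element of
the maximal domain. -/
theorem inner_incl_sq_dirac {φ : 𝓢(Plane, Spinor)} {μ : ℝ}
    (h : diracSchwartz δ c (diracSchwartz δ c φ) = (μ : ℂ) • φ)
    (ψ : (sq (dirac δ c)).domain) :
    ⟪incl φ, sq (dirac δ c) ψ⟫_ℂ = (μ : ℂ) * ⟪incl φ, (ψ : SpinorL2)⟫_ℂ := by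
  obtain ⟨ψ, hψ⟩ := ψ
  obtain ⟨h1, h2⟩ := mem_sq_domain.1 hψ
  rw [sq_apply hψ h1 h2, inner_incl_dirac, inner_incl_dirac, h, map_smul, inner_smul_left,
    Complex.conj_ofReal]

theorem spinL2_incl (M : Matrix (Fin 4) (Fin 4) ℂ) (φ : 𝓢(Plane, Spinor)) :
    spinL2 M (incl φ) = incl (spin M φ) := by
  refine Lp.ext ?_
  filter_upwards [ContinuousLinearMap.coeFn_compLpL (Matrix.toEuclideanCLM (𝕜 := ℂ) M) (incl φ),
    φ.coeFn_toLp 2 volume, (spin M φ).coeFn_toLp 2 volume] with q h1 h2 h3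
  change (spinL2 M (incl φ)) q = ((spin M φ).toLp 2 volume) q
  have h2' : incl φ q = φ q := h2
  rw [h3, spin_apply, ← h2']
  exact h1

theorem inner_spinL2_left {M : Matrix (Fin 4) (Fin 4) ℂ} (hM : M.IsHermitian) (ψ χ : SpinorL2) :
    ⟪spinL2 M ψ, χ⟫_ℂ = ⟪ψ, spinL2 M χ⟫_ℂ := by
  -- The parameters `0 0` are arbitrary: only the density of the Schwartz spinors matters.
  refine (dense_diracMin_domain 0 0).induction ?_ ?_ ψ
  · rintro _ ⟨φ, rfl⟩
    refine (dense_diracMin_domain 0 0).induction ?_ ?_ χ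
    · rintro _ ⟨φ', rfl⟩
      rw [spinL2_incl, spinL2_incl]
      exact isFormallySymmetric_spin hM φ φ'
    · exact isClosed_eq (by fun_prop) (by fun_prop)
  · exact isClosed_eq (by fun_prop) (by fun_prop)

theorem IsEuclideanClifford.isHermitian_chirality (hδ : IsEuclideanClifford δ) :
    ((Complex.I ^ 2)⁻¹ • (δ 0 * δ 1 * δ 2 * δ 3)).IsHermitian := by
  have h (i j : Fin 4) (hij : i ≠ j := by decide) : δ i * δ j = -(δ j * δ i) :=
    hδ.mul_comm_neg hij
  have h1 : δ 3 * (δ 2 * (δ 1 * δ 0)) = δ 0 * δ 1 * δ 2 * δ 3 := by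
    rw [h 1 0, mul_neg, mul_neg, ← mul_assoc (δ 3), h 3 2, neg_mul, neg_neg,
      hδ.commute_mul.symm.eq, mul_assoc (δ 0 * δ 1)]
  rw [Matrix.IsHermitian, Matrix.conjTranspose_smul, Matrix.conjTranspose_mul,
    Matrix.conjTranspose_mul, Matrix.conjTranspose_mul, (hδ.1 0).eq, (hδ.1 1).eq, (hδ.1 2).eq,
    (hδ.1 3).eq, h1, Complex.I_sq]
  simp

theorem IsEuclideanClifford.chirality_mul (hδ : IsEuclideanClifford δ) (i : Fin 4) :
    ((Complex.I ^ 2)⁻¹ • (δ 0 * δ 1 * δ 2 * δ 3)) * δ i =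
      -(δ i * ((Complex.I ^ 2)⁻¹ • (δ 0 * δ 1 * δ 2 * δ 3))) := by
  have h (i j : Fin 4) (hij : i ≠ j := by decide) : δ i * δ j = -(δ j * δ i) :=
    hδ.mul_comm_neg hij
  rw [smul_mul_assoc, mul_smul_comm, ← smul_neg]
  congr 1
  have h3 (i j : Fin 4) (M : Matrix (Fin 4) (Fin 4) ℂ) (hij : i ≠ j := by decide) :
      δ i * (δ j * M) = -(δ j * (δ i * M)) := by
    rw [← mul_assoc, h i j hij, neg_mul, mul_assoc]
  fin_cases i
  · change δ 0 * δ 1 * δ 2 * δ 3 * δ 0 = -(δ 0 * (δ 0 * δ 1 * δ 2 * δ 3))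
    simp only [mul_assoc]
    simp only [h 3 0, h3 2 0, h3 1 0, mul_neg, neg_neg]
  · change δ 0 * δ 1 * δ 2 * δ 3 * δ 1 = -(δ 1 * (δ 0 * δ 1 * δ 2 * δ 3))
    simp only [mul_assoc]
    simp only [h 3 1, h3 2 1, h3 1 0, mul_neg, neg_neg]
  · change δ 0 * δ 1 * δ 2 * δ 3 * δ 2 = -(δ 2 * (δ 0 * δ 1 * δ 2 * δ 3))
    simp only [mul_assoc]
    simp only [h 3 2, h3 2 0, h3 2 1, mul_neg, neg_neg]
  · change δ 0 * δ 1 * δ 2 * δ 3 * δ 3 = -(δ 3 * (δ 0 * δ 1 * δ 2 * δ 3))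
    simp only [mul_assoc]
    simp only [h3 3 0, h3 3 1, h3 3 2, mul_neg, neg_neg]

theorem spin_chirality_mul_diracSchwartz (hδ : IsEuclideanClifford δ) :
    spin ((Complex.I ^ 2)⁻¹ • (δ 0 * δ 1 * δ 2 * δ 3)) * diracSchwartz δ c =
      -(diracSchwartz δ c * spin ((Complex.I ^ 2)⁻¹ • (δ 0 * δ 1 * δ 2 * δ 3))) := by
  have h1 : ∀ i, spin ((Complex.I ^ 2)⁻¹ • (δ 0 * δ 1 * δ 2 * δ 3)) * spin (δ i) =
      -(spin (δ i) * spin ((Complex.I ^ 2)⁻¹ • (δ 0 * δ 1 * δ 2 * δ 3))) := fun i => by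
    simp only [← spinHom_apply, ← map_mul, ← map_neg, hδ.chirality_mul i]
  have key : ∀ (i : Fin 4) {A : SchwartzOp},
      Commute (spin ((Complex.I ^ 2)⁻¹ • (δ 0 * δ 1 * δ 2 * δ 3))) A →
      spin ((Complex.I ^ 2)⁻¹ • (δ 0 * δ 1 * δ 2 * δ 3)) * (spin (δ i) * A) =
        -(spin (δ i) * A * spin ((Complex.I ^ 2)⁻¹ • (δ 0 * δ 1 * δ 2 * δ 3))) := by
    intro i A hA
    rw [← mul_assoc, h1, neg_mul, mul_assoc (spin (δ i)), hA.eq, mul_assoc (spin (δ i))]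
  have hX (M) (j : Fin 2) : Commute (spin M) (pos j) := by
    rw [pos_eq_posAlong]
    exact commute_spin_posAlong _ _
  have hD (M) (j : Fin 2) : Commute (spin M) (mom j) := by
    rw [mom_eq_derivAlong]
    exact (commute_spin_derivAlong _ _).smul_right _
  rw [diracSchwartz_eq, mul_sub, mul_sub, mul_add,
    key 0 ((hX _ 0).sub_right ((hX _ 1).smul_right _)), key 1 (hD _ 0), key 2 (hX _ 1),
    key 3 (hD _ 1)]
  simp only [sub_mul, add_mul]
  abel

/-- In the weak equation the Hermitian matrix `θ` moves onto the Schwartz test spinor, where the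
anticommutation is algebraic. -/
theorem chirality_dirac (hδ : IsEuclideanClifford δ) (ψ : (dirac δ c).domain) :
    ∃ h : chirality δ ψ ∈ (dirac δ c).domain,
      dirac δ c ⟨chirality δ ψ, h⟩ = -chirality δ (dirac δ c ψ) := by
  refine exists_dirac_eq fun φ => ?_
  rw [chirality, inner_neg_right, ← inner_spinL2_left hδ.isHermitian_chirality, spinL2_incl,
    inner_incl_dirac, ← inner_spinL2_left hδ.isHermitian_chirality, spinL2_incl,
    ← mul_apply_eq_comp, ← mul_apply_eq_comp, spin_chirality_mul_diracSchwartz hδ, neg_apply,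
    map_neg, inner_neg_left]

end Dirac

/-! ### Reduction of the tilted branes to normal form -/

section Rotation

/-- The rotation of the embedding directions which brings the branes into normal form. -/
def normalRotation (w r : ℝ) : Matrix (Fin 4) (Fin 4) ℝ :=
  !![r * w, 0, r, 0; 0, r, 0, r * w; -r, 0, r * w, 0; 0, -(r * w), 0, r]

/-- The axes of the normal modes. -/
def normalAxes (w r : ℝ) : Fin 2 → Plane := ![!₂[r, -(r * w)], !₂[-(r * w), -r]]

variable {w r : ℝ} (h : r ^ 2 * (1 + w ^ 2) = 1)

include h

theorem normalRotation_mul_transpose : normalRotation w r * (normalRotation w r).transpose = 1 := by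
  ext i j
  fin_cases i <;> fin_cases j <;>
    simp [normalRotation, Matrix.mul_apply, Fin.sum_univ_four] <;> first | linear_combination h | ring1

theorem orthonormal_normalAxes : Orthonormal ℝ (normalAxes w r) := by
  have key : ∀ a b a' b' : ℝ, ⟪(!₂[a, b] : Plane), !₂[a', b']⟫_ℝ = a * a' + b * b' := by
    intro a b a' b'
    simp [PiLp.inner_apply, Fin.sum_univ_two]
    ring
  rw [orthonormal_iff_ite]
  intro i j
  fin_cases i <;> fin_cases j <;>
    simp only [normalAxes, Fin.zero_eta, Fin.mk_one, Matrix.cons_val, key, if_true,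
      zero_ne_one, one_ne_zero, if_false] <;>
    first | linear_combination h | ring1

/-- The orthonormal basis of the normal modes. -/
def normalBasis : OrthonormalBasis (Fin 2) ℝ Plane :=
  OrthonormalBasis.mk (orthonormal_normalAxes h)
    ((orthonormal_normalAxes h).linearIndependent.span_eq_top_of_card_eq_finrank (by simp)).ge

theorem normalBasis_apply (j : Fin 2) : normalBasis h j = normalAxes w r j := by
  simp [normalBasis]

variable {δ : Fin 4 → Matrix (Fin 4) (Fin 4) ℂ}

/-- This is a singular value decomposition. The matrix `(x, y) ↦ (x - c y, -y)` sends the two axes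
to `w` and `w⁻¹` times the unit vectors that define the new `δ_0` and `δ_2`. The orthogonal momentum
matrix `diag (1, -1)` sends the same axes to the unit vectors that define the new `δ_1` and `δ_3`.
-/
theorem diracSchwartz_eq_oscDirac (hw : 0 < w) {c : ℝ} (hc : w * c = w ^ 2 - 1) :
    diracSchwartz δ c =
      oscDirac (fun i => ∑ k, (normalRotation w r i k : ℂ) • δ k) ![w, w⁻¹] (normalBasis h) := by
  have hax0 : normalAxes w r 0 = r • EuclideanSpace.single 0 1 +
      (-(r * w)) • EuclideanSpace.single 1 1 := by
    ext j
    fin_cases j <;> simp [normalAxes]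
  have hax1 : normalAxes w r 1 = (-(r * w)) • EuclideanSpace.single 0 1 +
      (-r) • EuclideanSpace.single 1 1 := by
    ext j
    fin_cases j <;> simp [normalAxes]
  have hw' : (w : ℂ) ≠ 0 := by exact_mod_cast hw.ne'
  have hC : (r : ℂ) ^ 2 * (1 + (w : ℂ) ^ 2) = 1 := by exact_mod_cast h
  have hcC : (w : ℂ) * c = (w : ℂ) ^ 2 - 1 := by exact_mod_cast hc
  have hc' : (c : ℂ) = w - (w : ℂ)⁻¹ := by
    field_simp
    linear_combination hcC
  simp only [oscDirac, normalBasis_apply, hax0, hax1, posAlong_add, posAlong_smul, derivAlong_add,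
    derivAlong_smul, ← pos_eq_posAlong, Fin.sum_univ_four, ← spinHom_apply, map_add, map_smul]
  rw [diracSchwartz_eq, mom_eq_derivAlong, mom_eq_derivAlong]
  simp only [← spinHom_apply, normalRotation, Matrix.of_apply, Matrix.cons_val, Complex.ofReal_zero,
    zero_smul, add_zero, zero_add, Complex.ofReal_neg, Complex.ofReal_mul, Complex.ofReal_inv,
    mul_add, add_mul, mul_sub, smul_mul_assoc, mul_smul_comm, smul_add, smul_smul, hc']
  have hv : (w : ℂ) * (w : ℂ)⁻¹ = 1 := mul_inv_cancel₀ hw'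
  -- With the inverse replaced by a variable `v` subject to `w v = 1`, each coefficient identity is
  -- polynomial.
  generalize (w : ℂ)⁻¹ = v at hv ⊢
  match_scalars
  · linear_combination -hC - (r : ℂ) ^ 2 * hv
  · linear_combination (w - v) * hC + w * (r : ℂ) ^ 2 * hv
  · linear_combination Complex.I * hC
  · linear_combination hC + (r : ℂ) ^ 2 * hv
  · linear_combination -Complex.I * hC
  · linear_combination w * (r : ℂ) ^ 2 * hv
  · ring
  · ring

/-- The rotation acts separately in the planes of indices `0, 2` and `1, 3`, with determinant one in
each. The product of the two generators of each plane is therefore invariant. -/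
theorem normalRotation_product (hδ : IsEuclideanClifford δ) :
    (∑ k, (normalRotation w r 0 k : ℂ) • δ k) * (∑ k, (normalRotation w r 1 k : ℂ) • δ k) *
      (∑ k, (normalRotation w r 2 k : ℂ) • δ k) * (∑ k, (normalRotation w r 3 k : ℂ) • δ k) =
      δ 0 * δ 1 * δ 2 * δ 3 := by
  have hδ' := hδ.rotate (normalRotation_mul_transpose h)
  have hC : (r : ℂ) ^ 2 * (1 + (w : ℂ) ^ 2) = 1 := by exact_mod_cast h
  have h02 : (∑ k, (normalRotation w r 0 k : ℂ) • δ k) *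
      (∑ k, (normalRotation w r 2 k : ℂ) • δ k) = δ 0 * δ 2 := by
    simp only [Fin.sum_univ_four, normalRotation, Matrix.of_apply, Matrix.cons_val,
      Complex.ofReal_zero, zero_smul, add_zero, mul_add, add_mul, smul_mul_assoc,
      mul_smul_comm, hδ.mul_self, hδ.mul_comm_neg (show (2 : Fin 4) ≠ 0 by decide)]
    push_cast
    match_scalars
    · ring
    · linear_combination hC
  have h13 : (∑ k, (normalRotation w r 1 k : ℂ) • δ k) *
      (∑ k, (normalRotation w r 3 k : ℂ) • δ k) = δ 1 * δ 3 := by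
    simp only [Fin.sum_univ_four, normalRotation, Matrix.of_apply, Matrix.cons_val,
      Complex.ofReal_zero, zero_smul, add_zero, zero_add, mul_add, add_mul, smul_mul_assoc,
      mul_smul_comm, hδ.mul_self, hδ.mul_comm_neg (show (3 : Fin 4) ≠ 1 by decide)]
    push_cast
    match_scalars
    · ring
    · linear_combination hC
  have swap : ∀ {a b c d : Matrix (Fin 4) (Fin 4) ℂ}, b * c = -(c * b) →
      a * b * c * d = -(a * c * (b * d)) := fun {a b c d} hbc => by
    rw [mul_assoc a, hbc, mul_neg, neg_mul, mul_assoc a, mul_assoc c, mul_assoc a]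
  rw [swap (hδ'.mul_comm_neg (show (1 : Fin 4) ≠ 2 by decide)), h02, h13,
    ← swap (hδ.mul_comm_neg (show (1 : Fin 4) ≠ 2 by decide))]

end Rotation

end IntersectingBranes

end

/-! ### The main theorem -/

open IntersectingBranes in
theorem mainTheorem3 (δ : Fin 4 → Matrix (Fin 4) (Fin 4) ℂ) (hδ : IsEuclideanClifford δ)
    (c : ℝ) :
    Module.finrank ℂ (eigenspace (sq (dirac δ c)) 0) = 1 ∧
      (∀ ψ ∈ eigenspace (sq (dirac δ c)) 0, chirality δ ψ = ψ) ∧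
      HasIndex (dirac δ c) (chirality δ) 1 := by
  -- The frequency `w` is the positive root of `w² - c w - 1`; the other singular value is `w⁻¹`.
  obtain ⟨w, hw, hwc⟩ : ∃ w : ℝ, 0 < w ∧ w * c = w ^ 2 - 1 := by
    have hs := Real.sq_sqrt (show 0 ≤ c ^ 2 + 4 by positivity)
    refine ⟨(c + √(c ^ 2 + 4)) / 2, ?_, by linear_combination -hs / 4⟩
    have : |c| < √(c ^ 2 + 4) := by
      rw [← Real.sqrt_sq_eq_abs]
      exact Real.sqrt_lt_sqrt (sq_nonneg c) (by linarith)
    linarith [neg_abs_le c]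
  obtain ⟨r, hr⟩ : ∃ r : ℝ, r ^ 2 * (1 + w ^ 2) = 1 := by
    refine ⟨(√(1 + w ^ 2))⁻¹, ?_⟩
    rw [inv_pow, Real.sq_sqrt (by positivity), inv_mul_cancel₀ (by positivity)]
  set ω : Fin 2 → ℝ := ![w, w⁻¹]
  have hω : ∀ j, 0 < ω j := by
    intro j
    fin_cases j
    · exact hw
    · exact inv_pos.2 hw
  set e := normalBasis hr
  set δ' : Fin 4 → Matrix (Fin 4) (Fin 4) ℂ := fun i => ∑ k, (normalRotation w r i k : ℂ) • δ k
  have hδ' : IsEuclideanClifford δ' := hδ.rotate (normalRotation_mul_transpose hr)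
  have hD : diracSchwartz δ c = oscDirac δ' ω e := diracSchwartz_eq_oscDirac hr hw hwc
  have hprod : δ' 0 * δ' 1 * δ' 2 * δ' 3 = δ 0 * δ 1 * δ 2 * δ 3 := normalRotation_product hr hδ
  have hsym : IsFormallySymmetric (diracSchwartz δ c) := by
    rw [hD]
    exact isFormallySymmetric_oscDirac hδ' ω e
  have hexc : ∀ k, diracSchwartz δ c (diracSchwartz δ c (excited e hω δ' k)) =
      (energy ω k : ℂ) • excited e hω δ' k := fun k => by
    rw [hD]
    exact oscDirac_oscDirac_excited hω hδ' k
  -- From here on every eigenspace of the maximal operator is the span of explicit Schwartz spinors,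
  -- so kernel and chirality are read off from the ground states.
  have heig := eigenspace_eq_span (A := sq (dirac δ c)) (f := fun k => incl (excited e hω δ' k))
    (ν := energy ω) (fun k => incl_mem_eigenspace hsym (hexc k))
    (fun k ψ => inner_incl_sq_dirac (hexc k) ψ) (fun ψ hψ => eq_zero_of_inner_excited hω hψ)
    (finite_energy_le hω)
  have hker : Module.finrank ℂ (eigenspace (sq (dirac δ c)) 0) = 1 := by
    rw [heig]
    exact finrank_span_ground hω hδ'
  have hchir : ∀ ψ ∈ eigenspace (sq (dirac δ c)) 0, chirality δ ψ = ψ := by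
    intro ψ hψ
    rw [heig] at hψ
    induction hψ using Submodule.span_induction with
    | mem _ hx =>
      obtain ⟨k, hk, rfl⟩ := hx
      obtain ⟨i, rfl⟩ := (energy_eq_zero_iff hω k).1 (Complex.ofReal_eq_zero.1 hk)
      change chirality δ (incl (excited e hω δ' (0, 0, false, false, i))) =
        incl (excited e hω δ' (0, 0, false, false, i))
      rw [chirality, ← hprod, spinL2_incl, excited_ground, spin_vacuum, ← mul_apply_eq_comp,
        ← map_mul, hδ'.chirality_mul_vacuumProj]
    | zero => exact map_zero _
    | add _ _ _ _ h1 h2 => rw [map_add, h1, h2]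
    | smul a _ _ h1 => rw [map_smul, h1]
  exact ⟨hker, hchir, hasIndex_one heig (finite_energy_le hω) (lt_min (hω 0) (hω 1))
    (energy_ne_min hω) (energy_nonneg hω) (chirality_dirac hδ) hker hchir⟩
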